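/- Let $R$ be an integral domain that is not a field and such that $R/(m)$ is finite for every $m\in R^\times:=R\setminus\{0\}$. Let $Q(R)$ be its field of fractions. Let $\mathfrak{A}[R]$ be the universal unital C*-algebra generated by isometries $s_m$ ($m\in R^\times$) and unitaries $u^n$ ($n\in R$) subject to the relations, for all $k,m\in R^\times$ and $l,n\in R$: $s_ks_m=s_{km}$, $u^lu^n=u^{l+n}$, $s_mu^n=u^{mn}s_m$, and $\sum_{n+(m)\in R/(m)}u^ne_mu^{-n}=1$, where $e_m=s_ms_m^*$. Let $P=\{u^ne_mu^{-n}: m\in R^\times,\ n\in R\}$ and let $\mathfrak{D}[R]=C^*(P)\subseteq\mathfrak{A}[R]$. Then $\mathfrak{D}[R]$ is commutative, and there is a faithful conditional expectation $\Theta:\mathfrak{A}[R]\to\mathfrak{D}[R]$ (that is, a positive linear contraction onto $\mathfrak{D}[R]$ which is the identity on $\mathfrak{D}[R]$, is a $\mathfrak{D}[R]$-bimodule map, and satisfies $\Theta(x^*x)=0\Rightarrow x=0$) such that $$\Theta(s_m^*u^nfu^{-n'}s_{m'})=\delta_{m,m'}\,\delta_{n,n'}\;s_m^*u^nfu^{-n}s_m\qquad(m,m'\in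 R^\times;\ n,n'\in R;\ f\in P).$$ It is characterized by this formula: every bounded linear map $\mathfrak{A}[R]\to\mathfrak{D}[R]$ that satisfies the formula equals $\Theta$. Moreover, $\Theta$ is the following double average. Let $\hat G$ and $\hat H$ be the compact Pontryagin duals of the discrete groups $G=(Q(R)^\times,\cdot)$ and $H=(R,+)$, with normalized Haar measures, and let $\mathfrak{B}=C^*(\{e_m: m\in R^\times\}\cup\{u^n: n\in R\})\subseteq\mathfrak{A}[R]$. There are point-norm continuous actions $\alpha$ of $\hat G$ on $\mathfrak{A}[R]$ and $\beta$ of $\hat H$ on $\mathfrak{B}$ by *-automorphisms with $\alpha_\phi(s_m)=\phi(m)s_m$, $\alpha_\phi(u^n)=u^n$, $\beta_\chi(e_m)=e_m$, $\beta_\chi(u^n)=\chi(n)u^n$, and for every $x\in\mathfrak{A}[R]$ one has $$\int_{\hat G}\alpha_\phi(x)\,d\phi\in\mathfrak{B},\qquad \Theta(x)=\int_{\hat H}\beta_\chi\Big(\int_{\hat G}\alpha_\phi(x)\,d\phi\Big)d\chi .$$ -/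

import Mathlib

open scoped nonZeroDivisors

noncomputable section

namespace RingCStar

/-! ### The free unital complex *-algebra on a set of generators -/

/-- The free unital complex `*`-algebra on `X`: the monoid algebra of the words in the letters
`(x, false)`, standing for `x`, and `(x, true)`, standing for `x^*`. -/
abbrev FreeStarAlg (X : Type*) : Type _ := MonoidAlgebra ℂ (FreeMonoid (X × Bool))

namespace FreeStarAlg

variable {X : Type*}

/-- The letter `x` (for `b = false`) or `x^*` (for `b = true`). -/
def letter (x : X) (b : Bool) : FreeStarAlg X :=
  MonoidAlgebra.of ℂ (FreeMonoid (X × Bool)) (FreeMonoid.of (x, b))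

/-- The generator `x`. -/
def gen (x : X) : FreeStarAlg X := letter x false

theorem induction_on {P : FreeStarAlg X → Prop} (a : FreeStarAlg X)
    (h_scalar : ∀ c : ℂ, P (algebraMap ℂ _ c)) (h_letter : ∀ x b, P (letter x b))
    (h_add : ∀ a b, P a → P b → P (a + b)) (h_mul : ∀ a b, P a → P b → P (a * b)) : P a := by
  have h_one : P 1 := by rw [← map_one (algebraMap ℂ (FreeStarAlg X))]; exact h_scalar 1
  have h_word : ∀ w : FreeMonoid (X × Bool), P (MonoidAlgebra.of ℂ _ w : MonoidAlgebra ℂ _) := by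
    intro w
    induction w using FreeMonoid.inductionOn' with
    | one => rw [map_one]; exact h_one
    | of_mul x w ih => rw [map_mul]; exact h_mul _ _ (h_letter x.1 x.2) ih
  refine MonoidAlgebra.induction_on (motive := P) a h_word h_add ?_
  intro c f hf
  have := h_mul _ _ (h_scalar c) hf
  rwa [← Algebra.smul_def] at this

/-- The conjugate-linear ring homomorphism to the opposite algebra that exchanges `x` and `x^*`. -/
def starHom : FreeStarAlg X →+* (FreeStarAlg X)ᵐᵒᵖ :=
  MonoidAlgebra.liftNCRingHom
    ((algebraMap ℂ (FreeStarAlg X)ᵐᵒᵖ).comp (starRingEnd ℂ))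
    (FreeMonoid.lift fun p : X × Bool => MulOpposite.op (letter p.1 (!p.2)))
    (fun c _ => Algebra.commute_algebraMap_left (starRingEnd ℂ c) _)

theorem starHom_algebraMap (c : ℂ) :
    starHom (algebraMap ℂ (FreeStarAlg X) c) = algebraMap ℂ _ (starRingEnd ℂ c) := by
  have h : (algebraMap ℂ (FreeStarAlg X) c) = MonoidAlgebra.single 1 c := rfl
  rw [h, starHom]
  rw [MonoidAlgebra.liftNCRingHom_single]
  simp

theorem starHom_letter (x : X) (b : Bool) :
    starHom (letter x b) = MulOpposite.op (letter x (!b)) := by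
  rw [starHom, letter, MonoidAlgebra.of_apply, MonoidAlgebra.liftNCRingHom_single, map_one,
    one_mul, FreeMonoid.lift_eval_of]

instance : StarRing (FreeStarAlg X) where
  star a := (starHom a).unop
  star_involutive a := by
    induction a using induction_on with
    | h_scalar c =>
      beta_reduce
      rw [starHom_algebraMap, MulOpposite.algebraMap_apply, MulOpposite.unop_op,
        starHom_algebraMap, MulOpposite.algebraMap_apply, MulOpposite.unop_op, Complex.conj_conj]
    | h_letter x b =>
      beta_reduce
      rw [starHom_letter, MulOpposite.unop_op, starHom_letter, MulOpposite.unop_op, Bool.not_not]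
    | h_add a b ha hb => simp only [map_add, MulOpposite.unop_add, ha, hb]
    | h_mul a b ha hb => simp only [map_mul, MulOpposite.unop_mul, ha, hb]
  star_mul a b := by simp only [map_mul, MulOpposite.unop_mul]
  star_add a b := by simp only [map_add, MulOpposite.unop_add]

theorem star_def (a : FreeStarAlg X) : star a = (starHom a).unop := rfl

theorem star_letter (x : X) (b : Bool) : star (letter x b) = letter x (!b) := by
  rw [star_def, starHom_letter, MulOpposite.unop_op]

theorem star_algebraMap (c : ℂ) :
    star (algebraMap ℂ (FreeStarAlg X) c) = algebraMap ℂ _ (star c) := by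
  rw [star_def, starHom_algebraMap, MulOpposite.algebraMap_apply, MulOpposite.unop_op]; rfl

instance : StarModule ℂ (FreeStarAlg X) where
  star_smul c a := by
    rw [Algebra.smul_def, star_mul, star_algebraMap, Algebra.smul_def, Algebra.commutes]

end FreeStarAlg

/-! ### The defining relations -/

/-- The defining relations of `𝔄[R]`, for families `s` (indexed by the nonzero elements) and `u`
(indexed by all elements of `R`) in a unital `*`-ring: `Rel s u x y` says that `x = y` is one of
the required equations. In `partition` one representative is picked in each coset of `(m)`. -/
inductive Rel {R : Type*} [CommRing R] {B : Type*} [Ring B] [StarRing B]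
    (s : R⁰ → B) (u : R → B) : B → B → Prop
  | isometry (m : R⁰) : Rel s u (star (s m) * s m) 1
  | unitary_left (n : R) : Rel s u (star (u n) * u n) 1
  | unitary_right (n : R) : Rel s u (u n * star (u n)) 1
  | mul (k m : R⁰) : Rel s u (s k * s m) (s (k * m))
  | add (l n : R) : Rel s u (u l * u n) (u (l + n))
  | comm (m : R⁰) (n : R) : Rel s u (s m * u n) (u (m * n) * s m)
  | partition (m : R⁰) : Rel s u
      (∑ᶠ c : R ⧸ Ideal.span {(m : R)},
        u (Quotient.out c) * (s m * star (s m)) * u (-Quotient.out c)) 1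

/-- The families `s`, `u` satisfy all the defining relations. -/
def Satisfies {R : Type*} [CommRing R] {B : Type*} [Ring B] [StarRing B]
    (s : R⁰ → B) (u : R → B) : Prop :=
  ∀ x y, Rel s u x y → x = y

/-! ### The universal C*-algebra -/

/-- `p` is a C*-seminorm on the unital complex `*`-algebra `F`. -/
structure IsCStarSeminorm {F : Type*} [Ring F] [StarRing F] [Algebra ℂ F] (p : F → ℝ) : Prop where
  add_le : ∀ x y, p (x + y) ≤ p x + p y
  smul : ∀ (c : ℂ) x, p (c • x) = ‖c‖ * p x
  mul_le : ∀ x y, p (x * y) ≤ p x * p y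
  star_mul_self : ∀ x, p (star x * x) = p x ^ 2

section IsCStarSeminorm

variable {F : Type*} [Ring F] [StarRing F] [Algebra ℂ F] {p : F → ℝ}

theorem IsCStarSeminorm.zero (h : IsCStarSeminorm p) : p 0 = 0 := by
  simpa using h.smul 0 0

theorem IsCStarSeminorm.neg (h : IsCStarSeminorm p) (x : F) : p (-x) = p x := by
  simpa using h.smul (-1) x

theorem IsCStarSeminorm.nonneg (h : IsCStarSeminorm p) (x : F) : 0 ≤ p x := by
  have := h.add_le x (-x)
  rw [add_neg_cancel, h.zero, h.neg] at this
  linarith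

theorem IsCStarSeminorm.le_star (h : IsCStarSeminorm p) (x : F) : p x ≤ p (star x) := by
  by_contra hc
  push Not at hc
  have h0 := h.nonneg (star x)
  have h1 := h.mul_le (star x) x
  rw [h.star_mul_self] at h1
  nlinarith

theorem IsCStarSeminorm.map_star (h : IsCStarSeminorm p) (x : F) : p (star x) = p x :=
  le_antisymm (by simpa using h.le_star (star x)) (h.le_star x)

theorem IsCStarSeminorm.le_one_of_sq (h : IsCStarSeminorm p) {x : F}
    (hx : p (star x * x) ≤ 1) : p x ≤ 1 := by
  rw [h.star_mul_self] at hx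
  nlinarith

theorem IsCStarSeminorm.one_le (h : IsCStarSeminorm p) : p 1 ≤ 1 := by
  have h1 := h.star_mul_self 1
  rw [star_one, one_mul] at h1
  by_contra hc
  push Not at hc
  nlinarith

end IsCStarSeminorm

section Universal

variable (R : Type*) [CommRing R]

/-- The free `*`-algebra on symbols `s_m` (`m` nonzero) and `u^n` (`n : R`). -/
abbrev Pre : Type _ := FreeStarAlg (R⁰ ⊕ R)

variable {R}

/-- The symbol `s_m`. -/
def preS (m : R⁰) : Pre R := FreeStarAlg.gen (Sum.inl m)

/-- The symbol `u^n`. -/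
def preU (n : R) : Pre R := FreeStarAlg.gen (Sum.inr n)

variable (R)

/-- The C*-seminorms on the free `*`-algebra for which the defining relations hold. -/
def Admissible : Type _ :=
  {p : Pre R → ℝ // IsCStarSeminorm p ∧ ∀ x y, Rel preS preU x y → p (x - y) = 0}

instance : Nonempty (Admissible R) :=
  ⟨⟨fun _ => 0, ⟨by simp, by simp, by simp, by simp⟩, by simp⟩⟩

variable {R}

theorem Admissible.le_one_letter (p : Admissible R) (x : R⁰ ⊕ R) (b : Bool) :
    p.1 (FreeStarAlg.letter x b) ≤ 1 := by
  have key : ∀ a : Pre R, Rel preS preU (star a * a) 1 → p.1 a ≤ 1 := by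
    intro a ha
    refine p.2.1.le_one_of_sq ?_
    have h1 := p.2.2 _ _ ha
    have h2 := p.2.1.add_le (star a * a - 1) 1
    rw [sub_add_cancel, h1, zero_add] at h2
    exact h2.trans p.2.1.one_le
  have hgen : p.1 (FreeStarAlg.gen x) ≤ 1 := by
    rcases x with m | n
    · exact key _ (Rel.isometry m)
    · exact key _ (Rel.unitary_left n)
  cases b with
  | false => exact hgen
  | true =>
    have : FreeStarAlg.letter x true = star (FreeStarAlg.gen x) := by
      rw [FreeStarAlg.gen, FreeStarAlg.star_letter]; rfl
    rw [this, p.2.1.map_star]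
    exact hgen

theorem exists_bound (a : Pre R) : ∃ C : ℝ, ∀ p : Admissible R, p.1 a ≤ C := by
  induction a using FreeStarAlg.induction_on with
  | h_scalar c =>
    refine ⟨‖c‖, fun p => ?_⟩
    rw [Algebra.algebraMap_eq_smul_one, p.2.1.smul]
    exact mul_le_of_le_one_right (norm_nonneg _) p.2.1.one_le
  | h_letter x b => exact ⟨1, fun p => p.le_one_letter x b⟩
  | h_add a b ha hb =>
    obtain ⟨C, hC⟩ := ha
    obtain ⟨D, hD⟩ := hb
    exact ⟨C + D, fun p => (p.2.1.add_le a b).trans (add_le_add (hC p) (hD p))⟩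
  | h_mul a b ha hb =>
    obtain ⟨C, hC⟩ := ha
    obtain ⟨D, hD⟩ := hb
    exact ⟨C * D, fun p => (p.2.1.mul_le a b).trans
      (mul_le_mul (hC p) (hD p) (p.2.1.nonneg b) ((p.2.1.nonneg a).trans (hC p)))⟩

/-- The largest C*-seminorm on the free `*`-algebra for which the defining relations hold. -/
def univNorm (a : Pre R) : ℝ := ⨆ p : Admissible R, p.1 a

theorem le_univNorm (p : Admissible R) (a : Pre R) : p.1 a ≤ univNorm a := by
  obtain ⟨C, hC⟩ := exists_bound a
  exact le_ciSup (f := fun p : Admissible R => p.1 a) ⟨C, by rintro _ ⟨q, rfl⟩; exact hC q⟩ p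

theorem univNorm_le {a : Pre R} {C : ℝ} (h : ∀ p : Admissible R, p.1 a ≤ C) : univNorm a ≤ C :=
  ciSup_le h

theorem univNorm_nonneg (a : Pre R) : 0 ≤ univNorm a :=
  ((Classical.arbitrary (Admissible R)).2.1.nonneg a).trans (le_univNorm _ a)

theorem isCStarSeminorm_univNorm : IsCStarSeminorm (univNorm (R := R)) where
  add_le x y := univNorm_le fun p =>
    (p.2.1.add_le x y).trans (add_le_add (le_univNorm p x) (le_univNorm p y))
  smul c x := by
    unfold univNorm
    rw [Real.mul_iSup_of_nonneg (norm_nonneg c)]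
    exact iSup_congr fun p => p.2.1.smul c x
  mul_le x y := univNorm_le fun p => (p.2.1.mul_le x y).trans
    (mul_le_mul (le_univNorm p x) (le_univNorm p y) (p.2.1.nonneg y) (univNorm_nonneg x))
  star_mul_self x := by
    refine le_antisymm (univNorm_le fun p => ?_) ?_
    · rw [p.2.1.star_mul_self]
      exact pow_le_pow_left₀ (p.2.1.nonneg x) (le_univNorm p x) 2
    · have h : univNorm x ≤ √(univNorm (star x * x)) := univNorm_le fun p => by
        apply Real.le_sqrt_of_sq_le
        rw [← p.2.1.star_mul_self]
        exact le_univNorm p _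
      calc univNorm x ^ 2 ≤ √(univNorm (star x * x)) ^ 2 :=
            pow_le_pow_left₀ (univNorm_nonneg x) h 2
        _ = _ := Real.sq_sqrt (univNorm_nonneg _)

theorem univNorm_rel {x y : Pre R} (h : Rel preS preU x y) : univNorm (x - y) = 0 :=
  le_antisymm (univNorm_le fun p => (p.2.2 x y h).le) (univNorm_nonneg _)

instance : SeminormedRing (Pre R) where
  norm := univNorm
  dist x y := univNorm (-x + y)
  dist_self x := by simpa using isCStarSeminorm_univNorm.zero
  dist_comm x y := by
    rw [← isCStarSeminorm_univNorm.neg]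
    congr 1
    abel
  dist_triangle x y z := by
    have := isCStarSeminorm_univNorm.add_le (-x + y) (-y + z)
    rwa [show -x + y + (-y + z) = -x + z by abel] at this
  dist_eq _ _ := rfl
  norm_mul_le := isCStarSeminorm_univNorm.mul_le

theorem norm_def (a : Pre R) : ‖a‖ = univNorm a := rfl

instance : NormedAlgebra ℂ (Pre R) where
  norm_smul_le c x := (isCStarSeminorm_univNorm.smul c x).le

variable (R)

/-- The universal C*-algebra `𝔄[R]`: the Hausdorff completion of the free `*`-algebra with respect
to its largest C*-seminorm that respects the defining relations. -/
def Alg : Type _ := UniformSpace.Completion (Pre R)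

variable {R}

instance : NormedRing (Alg R) := inferInstanceAs (NormedRing (UniformSpace.Completion (Pre R)))

instance : CompleteSpace (Alg R) :=
  inferInstanceAs (CompleteSpace (UniformSpace.Completion (Pre R)))

instance : Algebra ℂ (Alg R) := inferInstanceAs (Algebra ℂ (UniformSpace.Completion (Pre R)))

instance : NormedAlgebra ℂ (Alg R) where
  norm_smul_le c x := norm_smul_le c (show UniformSpace.Completion (Pre R) from x)

/-- The canonical map from the free `*`-algebra. -/
def ofPre : Pre R →+* Alg R := UniformSpace.Completion.coeRingHom

theorem norm_ofPre (a : Pre R) : ‖ofPre a‖ = ‖a‖ := UniformSpace.Completion.norm_coe a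

theorem ofPre_smul (c : ℂ) (a : Pre R) : ofPre (c • a) = c • ofPre a :=
  UniformSpace.Completion.coe_smul c a

theorem denseRange_ofPre : DenseRange (ofPre (R := R)) :=
  UniformSpace.Completion.denseRange_coe

theorem uniformContinuous_star_pre : UniformContinuous (star : Pre R → Pre R) := by
  refine (AddMonoidHomClass.isometry_of_norm (starAddEquiv : Pre R ≃+ Pre R) ?_).uniformContinuous
  exact fun x => isCStarSeminorm_univNorm.map_star x

instance : Star (Alg R) := ⟨UniformSpace.Completion.map star⟩

theorem star_ofPre (a : Pre R) : star (ofPre a) = ofPre (star a) :=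
  UniformSpace.Completion.map_coe uniformContinuous_star_pre a

theorem continuous_star_alg : Continuous (star : Alg R → Alg R) :=
  UniformSpace.Completion.continuous_map

theorem alg_induction {P : Alg R → Prop} (hc : IsClosed {x | P x}) (h : ∀ a, P (ofPre a))
    (x : Alg R) : P x :=
  UniformSpace.Completion.induction_on x hc h

instance : StarRing (Alg R) where
  star_involutive x := by
    refine alg_induction (P := fun x => star (star x) = x) ?_ ?_ x
    · exact isClosed_eq (continuous_star_alg.comp continuous_star_alg) continuous_id
    · intro a; rw [star_ofPre, star_ofPre, star_star]
  star_mul x y := by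
    have hs := continuous_star_alg (R := R)
    refine alg_induction (P := fun x => star (x * y) = star y * star x) ?_ ?_ x
    · exact isClosed_eq (by fun_prop) (by fun_prop)
    intro a
    refine alg_induction (P := fun y => star (ofPre a * y) = star y * star (ofPre a)) ?_ ?_ y
    · exact isClosed_eq (by fun_prop) (by fun_prop)
    intro b
    rw [← map_mul, star_ofPre, star_ofPre, star_ofPre, star_mul, map_mul]
  star_add x y := by
    have hs := continuous_star_alg (R := R)
    refine alg_induction (P := fun x => star (x + y) = star x + star y) ?_ ?_ x
    · exact isClosed_eq (by fun_prop) (by fun_prop)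
    intro a
    refine alg_induction (P := fun y => star (ofPre a + y) = star (ofPre a) + star y) ?_ ?_ y
    · exact isClosed_eq (by fun_prop) (by fun_prop)
    intro b
    rw [← map_add, star_ofPre, star_ofPre, star_ofPre, star_add, map_add]

instance : CStarAlgebra (Alg R) where
  norm_mul_self_le x := by
    have hs := continuous_star_alg (R := R)
    refine alg_induction (P := fun x => ‖x‖ * ‖x‖ ≤ ‖star x * x‖) ?_ ?_ x
    · exact isClosed_le (by fun_prop) (by fun_prop)
    intro a
    rw [star_ofPre, ← map_mul, norm_ofPre, norm_ofPre, norm_def, norm_def,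
      isCStarSeminorm_univNorm.star_mul_self, sq]
  star_smul c x := by
    have hs := continuous_star_alg (R := R)
    refine alg_induction (P := fun x => star (c • x) = star c • star x) ?_ ?_ x
    · exact isClosed_eq (hs.comp (continuous_const_smul c)) (hs.const_smul (star c))
    intro a
    rw [← ofPre_smul, star_ofPre, star_ofPre, star_smul, ofPre_smul]

/-- The isometry `s_m` in `𝔄[R]`. -/
def s (m : R⁰) : Alg R := ofPre (preS m)

/-- The unitary `u^n` in `𝔄[R]`. -/
def u (n : R) : Alg R := ofPre (preU n)

/-- The range projection `e_m = s_m s_m^*`. -/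
def e (m : R⁰) : Alg R := s m * star (s m)

/-- Ring homomorphisms that respect the involution preserve the defining relations. -/
theorem Rel.map {B C : Type*} [Ring B] [StarRing B] [Ring C] [StarRing C]
    (hfin : ∀ m : R, m ≠ 0 → Finite (R ⧸ Ideal.span {m})) (f : B →+* C)
    (hf : ∀ b, f (star b) = star (f b)) {s' : R⁰ → B} {u' : R → B} [Nontrivial R] {x y : B}
    (h : Rel s' u' x y) : Rel (fun m => f (s' m)) (fun n => f (u' n)) (f x) (f y) := by
  cases h with
  | isometry m => rw [map_mul, hf, map_one]; exact .isometry (s := fun m => f (s' m)) m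
  | unitary_left n => rw [map_mul, hf, map_one]; exact .unitary_left (u := fun m => f (u' m)) n
  | unitary_right n => rw [map_mul, hf, map_one]; exact .unitary_right (u := fun m => f (u' m)) n
  | mul k m => rw [map_mul]; exact .mul (s := fun m => f (s' m)) k m
  | add l n => rw [map_mul]; exact .add (u := fun m => f (u' m)) l n
  | comm m n =>
    rw [map_mul, map_mul]
    exact .comm (s := fun m => f (s' m)) (u := fun m => f (u' m)) m n
  | partition m =>
    have := hfin m (nonZeroDivisors.coe_ne_zero m)
    have h := Rel.partition (s := fun m => f (s' m)) (u := fun m => f (u' m)) m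
    rw [map_one]
    convert h using 1
    have h2 := AddMonoidHom.map_finsum (f : B →+ C)
      (Set.toFinite (Function.support fun c : R ⧸ Ideal.span {(m : R)} =>
        u' (Quotient.out c) * (s' m * star (s' m)) * u' (-Quotient.out c)))
    refine h2.trans (finsum_congr fun c => ?_)
    simp [hf]

/-- The generators of `𝔄[R]` satisfy the defining relations. -/
theorem satisfies_generators [Nontrivial R]
    (hfin : ∀ m : R, m ≠ 0 → Finite (R ⧸ Ideal.span {m})) :
    Satisfies (s (R := R)) (u (R := R)) := by
  have key : ∀ x y : Pre R, Rel preS preU x y → ofPre x = ofPre y := by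
    intro x y h
    rw [← sub_eq_zero, ← map_sub, ← norm_eq_zero, norm_ofPre]
    exact univNorm_rel h
  have hs : ∀ a : Pre R, star (ofPre a) = ofPre (star a) := star_ofPre
  intro x y h
  cases h with
  | isometry m => simpa [hs, s] using key _ _ (.isometry m)
  | unitary_left n => simpa [hs, u] using key _ _ (.unitary_left n)
  | unitary_right n => simpa [hs, u] using key _ _ (.unitary_right n)
  | mul k m => simpa [hs, s] using key _ _ (.mul k m)
  | add l n => simpa [hs, u] using key _ _ (.add l n)
  | comm m n => simpa [hs, s, u] using key _ _ (.comm m n)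
  | partition m =>
    have := hfin m (nonZeroDivisors.coe_ne_zero m)
    have h1 := key _ _ (.partition m)
    rw [map_one] at h1
    rw [← h1]
    have h2 := AddMonoidHom.map_finsum (ofPre : Pre R →+* Alg R).toAddMonoidHom
      (Set.toFinite (Function.support fun c : R ⧸ Ideal.span {(m : R)} =>
        preU (Quotient.out c) * (preS m * star (preS m)) * preU (-Quotient.out c)))
    refine ((h2.trans (finsum_congr fun c => ?_))).symm
    simp [hs, s, u]

/-- Evaluation of the free `*`-algebra at elements of a C*-algebra. -/
def evalPre {B : Type*} [CStarAlgebra B] (s' : R⁰ → B) (u' : R → B) : Pre R →ₐ[ℂ] B :=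
  MonoidAlgebra.lift ℂ B _ (FreeMonoid.lift fun q : (R⁰ ⊕ R) × Bool =>
    if q.2 then star (Sum.elim s' u' q.1) else Sum.elim s' u' q.1)

theorem evalPre_letter {B : Type*} [CStarAlgebra B] (s' : R⁰ → B) (u' : R → B)
    (x : R⁰ ⊕ R) (b : Bool) : evalPre s' u' (FreeStarAlg.letter x b) =
      if b then star (Sum.elim s' u' x) else Sum.elim s' u' x := by
  rw [evalPre, FreeStarAlg.letter, MonoidAlgebra.lift_of, FreeMonoid.lift_eval_of]

theorem evalPre_star {B : Type*} [CStarAlgebra B] (s' : R⁰ → B) (u' : R → B) (a : Pre R) :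
    evalPre s' u' (star a) = star (evalPre s' u' a) := by
  induction a using FreeStarAlg.induction_on with
  | h_scalar c =>
    rw [FreeStarAlg.star_algebraMap, AlgHom.commutes, AlgHom.commutes, algebraMap_star_comm]
  | h_letter x b => rw [FreeStarAlg.star_letter, evalPre_letter, evalPre_letter]; cases b <;> simp
  | h_add a b ha hb => rw [star_add, map_add, map_add, star_add, ha, hb]
  | h_mul a b ha hb => rw [star_mul, map_mul, map_mul, star_mul, ha, hb]

open scoped CStarAlgebra in
/-- The universal property of `𝔄[R]`, for C*-algebras in every universe. -/
theorem existsUnique_lift [Nontrivial R] (hfin : ∀ m : R, m ≠ 0 → Finite (R ⧸ Ideal.span {m}))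
    {B : Type*} [CStarAlgebra B] (s' : R⁰ → B) (u' : R → B) (h : Satisfies s' u') :
    ∃! π : Alg R →⋆ₐ[ℂ] B, (∀ m, π (s m) = s' m) ∧ ∀ n, π (u n) = u' n := by
  set ev := evalPre s' u' with hev
  have evS : ∀ m, ev (preS m) = s' m := fun m => by
    rw [hev, preS, FreeStarAlg.gen, evalPre_letter]; simp
  have evU : ∀ m, ev (preU m) = u' m := fun m => by
    rw [hev, preU, FreeStarAlg.gen, evalPre_letter]; simp
  have hstar : ∀ a, ev (star a) = star (ev a) := evalPre_star s' u'
  let p : Admissible R := ⟨fun a => ‖ev a‖,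
    ⟨fun x y => by rw [map_add]; exact norm_add_le _ _,
      fun c x => by rw [map_smul, norm_smul],
      fun x y => by rw [map_mul]; exact norm_mul_le _ _,
      fun x => by rw [map_mul, hstar, CStarRing.norm_star_mul_self, sq]⟩, by
    intro x y hxy
    have h1 := Rel.map hfin (ev : Pre R →+* B) hstar hxy
    have h2 : ev x = ev y := by
      apply h
      convert h1 using 1
      · funext m; exact (evS m).symm
      · funext m; exact (evU m).symm
      · rfl
      · rfl
    beta_reduce
    rw [map_sub, h2, sub_self, norm_zero]⟩
  have hle : ∀ a, ‖ev a‖ ≤ ‖a‖ := fun a => le_univNorm p a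
  have hcont : Continuous (ev : Pre R →+* B) :=
    AddMonoidHomClass.continuous_of_bound (ev : Pre R →+* B) 1 fun a => by
      rw [one_mul]; exact hle a
  let f : Alg R →+* B := UniformSpace.Completion.extensionHom (ev : Pre R →+* B) hcont
  have hf : ∀ a, f (ofPre a) = ev a := fun a =>
    UniformSpace.Completion.extensionHom_coe (ev : Pre R →+* B) hcont a
  have hfc : Continuous f := UniformSpace.Completion.continuous_extension
  have hsc := continuous_star_alg (R := R)
  have hsmul : ∀ (c : ℂ) x, f (c • x) = c • f x := fun c x => by
    refine alg_induction (P := fun x => f (c • x) = c • f x) ?_ ?_ x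
    · exact isClosed_eq (hfc.comp (continuous_const_smul c)) (hfc.const_smul c)
    · intro a; rw [← ofPre_smul, hf, hf, map_smul]
  have hfstar : ∀ x, f (star x) = star (f x) := fun x => by
    refine alg_induction (P := fun x => f (star x) = star (f x)) ?_ ?_ x
    · exact isClosed_eq (hfc.comp hsc) (continuous_star.comp hfc)
    · intro a; rw [star_ofPre, hf, hf, hstar]
  let π : Alg R →⋆ₐ[ℂ] B :=
    { f with
      commutes' := fun c => by
        change f (algebraMap ℂ _ c) = _
        rw [Algebra.algebraMap_eq_smul_one, hsmul, map_one, Algebra.algebraMap_eq_smul_one]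
      map_star' := hfstar }
  refine ⟨π, ⟨fun m => (hf _).trans (evS m), fun n => (hf _).trans (evU n)⟩, ?_⟩
  rintro ρ ⟨hρs, hρu⟩
  have hρc : Continuous ρ := map_continuous ρ
  have hpre : ∀ a, ρ (ofPre a) = f (ofPre a) := by
    intro a
    have hgen : ∀ x, ρ (ofPre (FreeStarAlg.gen x)) = f (ofPre (FreeStarAlg.gen x)) := by
      rintro (m | n)
      · exact (hρs m).trans ((hf _).trans (evS m)).symm
      · exact (hρu n).trans ((hf _).trans (evU n)).symm
    induction a using FreeStarAlg.induction_on with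
    | h_scalar c =>
      rw [Algebra.algebraMap_eq_smul_one, ofPre_smul, map_smul, hsmul, map_one, map_one, map_one]
    | h_letter x b =>
      cases b with
      | false => exact hgen x
      | true =>
        have : FreeStarAlg.letter x true = star (FreeStarAlg.gen x) := by
          rw [FreeStarAlg.gen, FreeStarAlg.star_letter]; rfl
        rw [this, ← star_ofPre, map_star, hfstar, hgen]
    | h_add a b ha hb => rw [map_add, map_add, map_add, ha, hb]
    | h_mul a b ha hb => rw [map_mul, map_mul, map_mul, ha, hb]
  ext x
  exact alg_induction (P := fun x => ρ x = f x) (isClosed_eq hρc hfc) hpre x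

variable (R)

/-! ### The commutative subalgebra `𝔇[R]` and conditional expectations -/

/-- The set `P` of the projections `u^n e_m u^{-n}`. -/
def projSet : Set (Alg R) := {f | ∃ (m : R⁰) (n : R), f = u n * e m * u (-n)}

/-- `𝔇[R] = C^*(P)`. -/
def diagAlg : StarSubalgebra ℂ (Alg R) := (StarAlgebra.adjoin ℂ (projSet R)).topologicalClosure

end Universal

/-- `Θ` is a conditional expectation of the C*-algebra `A` onto its subalgebra `D`: a positive
contraction with values in `D` that is the identity on `D` and a `D`-bimodule map. -/
structure IsCondExp {A : Type*} [CStarAlgebra A] (D : StarSubalgebra ℂ A) (Θ : A →L[ℂ] D) :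
    Prop where
  contractive : ∀ x, ‖Θ x‖ ≤ ‖x‖
  positive : ∀ x : A, ∃ y : D, Θ (star x * x) = star y * y
  apply_coe : ∀ d : D, Θ d = d
  left_mul : ∀ (d : D) (x : A), Θ (d * x) = d * Θ x
  right_mul : ∀ (x : A) (d : D), Θ (x * d) = Θ x * d

/-- `Θ` is faithful: it vanishes on no nonzero positive element. -/
def IsFaithful {A : Type*} [CStarAlgebra A] {D : StarSubalgebra ℂ A} (Θ : A →L[ℂ] D) : Prop :=
  ∀ x : A, Θ (star x * x) = 0 → x = 0

open Classical in
/-- The Kronecker symbol. -/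
def delta {ι : Type*} (i j : ι) : ℂ := if i = j then 1 else 0

/-- `Θ(s_m^* u^n f u^{-n'} s_{m'}) = δ_{m,m'} δ_{n,n'} s_m^* u^n f u^{-n} s_m`. -/
def StandardFormula {R : Type*} [CommRing R] (Θ : Alg R →L[ℂ] diagAlg R) : Prop :=
  ∀ (m m' : R⁰) (n n' : R), ∀ f ∈ projSet R,
    (Θ (star (s m) * u n * f * u (-n') * s m') : Alg R) =
      (delta m m' * delta n n') • (star (s m) * u n * f * u (-n) * s m)

/-! ### Dual groups and averages -/

/-- The group `G` with the discrete topology. -/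
def Disc (G : Type*) : Type _ := G

instance {G : Type*} [CommGroup G] : CommGroup (Disc G) := inferInstanceAs (CommGroup G)

instance {G : Type*} : TopologicalSpace (Disc G) := ⊥

instance {G : Type*} : DiscreteTopology (Disc G) := ⟨rfl⟩

/-- The (compact) Pontryagin dual of the discrete abelian group `G`. -/
abbrev Dual (G : Type*) [CommGroup G] : Type _ := PontryaginDual (Disc G)

instance {G : Type*} [CommGroup G] : MeasurableSpace (Dual G) := borel _

instance {G : Type*} [CommGroup G] : BorelSpace (Dual G) := ⟨rfl⟩

/-- The value of a character. -/
def Dual.val {G : Type*} [CommGroup G] (χ : Dual G) (g : G) : ℂ := (χ (show Disc G from g) : Circle)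

/-- The normalized Haar measure on the dual group. -/
def dualHaar (G : Type*) [CommGroup G] : MeasureTheory.Measure (Dual G) :=
  MeasureTheory.Measure.haarMeasure ⊤

section Averages

variable (R : Type*) [CommRing R]

/-- `C^*({e_m} ∪ {u^n})`. -/
def coreAlg : StarSubalgebra ℂ (Alg R) :=
  (StarAlgebra.adjoin ℂ (Set.range (e (R := R)) ∪ Set.range (u (R := R)))).topologicalClosure

variable {R}

/-- `e_m` as an element of `C^*({e_m} ∪ {u^n})`. -/
def coreE (m : R⁰) : coreAlg R :=
  ⟨e m, StarSubalgebra.le_topologicalClosure _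
    (StarAlgebra.subset_adjoin ℂ _ (Or.inl ⟨m, rfl⟩))⟩

/-- `u^n` as an element of `C^*({e_m} ∪ {u^n})`. -/
def coreU (n : R) : coreAlg R :=
  ⟨u n, StarSubalgebra.le_topologicalClosure _
    (StarAlgebra.subset_adjoin ℂ _ (Or.inr ⟨n, rfl⟩))⟩

/-- A nonzero element of `R` as an element of the multiplicative group of the fraction field. -/
def toFrac (m : R⁰) : (FractionRing R)ˣ := (IsLocalization.map_units (FractionRing R) m).unit

/-- `α` is the point-norm continuous action of the dual of `Q(R)^×` on `𝔄[R]` with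
`α_φ(s_m) = φ(m) s_m` and `α_φ(u^n) = u^n`. -/
structure IsMulDualAction (α : Dual (FractionRing R)ˣ →* (Alg R ≃⋆ₐ[ℂ] Alg R)) : Prop where
  apply_s : ∀ φ m, α φ (s m) = φ.val (toFrac m) • s m
  apply_u : ∀ φ n, α φ (u n) = u n
  continuous : ∀ x, Continuous fun φ => α φ x

/-- `β` is the point-norm continuous action of the dual of `(R, +)` on `C^*({e_m} ∪ {u^n})` with
`β_χ(e_m) = e_m` and `β_χ(u^n) = χ(n) u^n`. -/
structure IsAddDualAction (β : Dual (Multiplicative R) →* (coreAlg R ≃⋆ₐ[ℂ] coreAlg R)) :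
    Prop where
  apply_e : ∀ χ m, β χ (coreE m) = coreE m
  apply_u : ∀ χ n, β χ (coreU n) = χ.val (Multiplicative.ofAdd n) • coreU n
  continuous : ∀ y, Continuous fun χ => β χ y

/-- `Θ` is obtained by averaging: for every `x`, the average `y` of `α_φ(x)` over the dual of
`Q(R)^×` lies in `C^*({e_m} ∪ {u^n})`, and `Θ(x)` is the average of `β_χ(y)` over the dual
of `(R, +)`. -/
def IsDoubleAverage (Θ : Alg R →L[ℂ] diagAlg R)
    (α : Dual (FractionRing R)ˣ →* (Alg R ≃⋆ₐ[ℂ] Alg R))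
    (β : Dual (Multiplicative R) →* (coreAlg R ≃⋆ₐ[ℂ] coreAlg R)) : Prop :=
  ∀ x : Alg R, ∃ y : coreAlg R,
    (y : Alg R) = ∫ φ, α φ x ∂(dualHaar (FractionRing R)ˣ) ∧
    (Θ x : Alg R) = ∫ χ, (β χ y : Alg R) ∂(dualHaar (Multiplicative R))

end Averages

end RingCStar

end

/-!
The elements `s_m^* u^a e_k u^b s_{m'}` span a dense subspace of `𝔄[R]`, because `s_l s_m^*`
equals `s_m^* e_{ml} s_l` and because `e_k` splits as a sum of projections `u^c e_{km} u^{-c}`, so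
that any two elements `u^a e_k u^b` can be written over the same denominator. The universal property
rescales `s_m` by a character of `Q(R)^×`; averaging kills the spanning elements with `m ≠ m'`, and
the remaining ones lie in `𝔅`, since compressing `u^a e_{km} u^b` by `s_m` yields an element of the
same kind or zero.

The action on `𝔅` does not come from a universal property. If a character of `R` is trivial on
some `(k)`, it is implemented by a unitary in the finite-dimensional algebra spanned by the
projections `u^c e_k u^{-c}`, so rescaling the `u^n` by it preserves norms. As `R` is not a field,
every nonzero `n` is missed by some `(k)`, so such characters separate the points of `R`. The norm
of a rescaled noncommutative polynomial in the `e_m`, `u^n` is a continuous function on the dual of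
`(R, +)` that is invariant under translation by these characters; its Fourier coefficients at all
`n ≠ 0` therefore vanish, so it is constant.

The average over the second action kills the elements with `a + b ≠ 0` and leaves `𝔇[R]`. Both
averages are faithful because a continuous nonnegative function with integral zero vanishes.
-/

noncomputable section

namespace RingCStar

/-! ### Relations between the generators -/

theorem FreeStarAlg.letter_true {X : Type*} (x : X) : letter x true = star (gen x) := by
  rw [gen, star_letter, Bool.not_false]

section Relations

variable {R : Type*} [CommRing R]

theorem hasFiniteQuotients_of_principal
    (h : ∀ m : R, m ≠ 0 → Finite (R ⧸ Ideal.span {m})) : Ring.HasFiniteQuotients R where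
  finiteQuotient {I} hI := by
    obtain ⟨m, hmI, hm⟩ := Submodule.exists_mem_ne_zero_of_ne_bot hI
    have := h m hm
    exact Finite.of_surjective _
      (Ideal.Quotient.factor_surjective ((Ideal.span_singleton_le_iff_mem I).2 hmI))

/-- The element `u^a e_k u^b`. These elements span a dense subspace of `coreAlg R`; those
with `a + b = 0` are the projections in `projSet R`. -/
def coreWord (k : R⁰) (a b : R) : Alg R := u a * e k * u b

/-- The projection `u^n e_k u^{-n}`. -/
abbrev proj (k : R⁰) (n : R) : Alg R := coreWord k n (-n)

/-- The element `s_m^* u^a e_k u^b s_{m'}`. These elements span a dense subspace of `𝔄[R]`. -/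
def word (m k : R⁰) (a b : R) (m' : R⁰) : Alg R := star (s m) * coreWord k a b * s m'

variable (R) in
/-- The linear span of the elements `u^a e_k u^b`. -/
def coreSpan : Submodule ℂ (Alg R) :=
  Submodule.span ℂ {x | ∃ (k : R⁰) (a b : R), x = coreWord k a b}

variable (R) in
/-- The linear span of the elements `s_m^* u^a e_k u^b s_{m'}`. -/
def wordSpan : Submodule ℂ (Alg R) :=
  Submodule.span ℂ {x | ∃ (m k : R⁰) (a b : R) (m' : R⁰), x = word m k a b m'}

theorem proj_mem_projSet (k : R⁰) (n : R) : proj k n ∈ projSet R := ⟨k, n, rfl⟩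

theorem coreWord_mem_coreSpan (k : R⁰) (a b : R) : coreWord k a b ∈ coreSpan R :=
  Submodule.subset_span ⟨k, a, b, rfl⟩

theorem word_mem_wordSpan (m k : R⁰) (a b : R) (m' : R⁰) : word m k a b m' ∈ wordSpan R :=
  Submodule.subset_span ⟨m, k, a, b, m', rfl⟩

theorem star_s_mul_mul_s_mem_wordSpan {y : Alg R} (hy : y ∈ coreSpan R) (m m' : R⁰) :
    star (s m) * y * s m' ∈ wordSpan R := by
  let φ : Alg R →ₗ[ℂ] Alg R := LinearMap.mulLeftRight ℂ (star (s m), s m')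
  suffices h : coreSpan R ≤ (wordSpan R).comap φ from h hy
  refine Submodule.span_le.2 ?_
  rintro _ ⟨k, a, b, rfl⟩
  exact word_mem_wordSpan m k a b m'

theorem mul_mem_wordSpan {x : Alg R}
    (hx : ∀ (m k : R⁰) (a b : R) (m' : R⁰), x * word m k a b m' ∈ wordSpan R)
    {y : Alg R} (hy : y ∈ wordSpan R) : x * y ∈ wordSpan R := by
  suffices h : wordSpan R ≤ (wordSpan R).comap (LinearMap.mulLeft ℂ x) from h hy
  refine Submodule.span_le.2 ?_
  rintro _ ⟨m, k, a, b, m', rfl⟩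
  exact hx m k a b m'

variable [Ring.HasFiniteQuotients R]

theorem finite_quotient_span_singleton (m : R) (hm : m ≠ 0) : Finite (R ⧸ Ideal.span {m}) :=
  Ring.HasFiniteQuotients.finiteQuotient (mt Ideal.span_singleton_eq_bot.1 hm)

variable [Nontrivial R]

instance (m : R⁰) : Fintype (R ⧸ Ideal.span {(m : R)}) :=
  have := finite_quotient_span_singleton (m : R) (nonZeroDivisors.coe_ne_zero m)
  Fintype.ofFinite _

theorem eq_of_rel {x y : Alg R} (h : Rel s u x y) : x = y :=
  satisfies_generators finite_quotient_span_singleton x y h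

@[simp]
theorem star_s_mul_s (m : R⁰) : star (s m) * s m = 1 := eq_of_rel (.isometry m)

theorem s_mul_s (k m : R⁰) : s k * s m = s (k * m) := eq_of_rel (.mul k m)

theorem star_s_mul_star_s (k m : R⁰) : star (s k) * star (s m) = star (s (k * m)) := by
  rw [← star_mul, s_mul_s, mul_comm]

theorem u_mul_u (l n : R) : u l * u n = u (l + n) := eq_of_rel (.add l n)

theorem star_u_mul_u (n : R) : star (u n) * u n = 1 := eq_of_rel (.unitary_left n)

theorem s_mul_u (m : R⁰) (n : R) : s m * u n = u (m * n) * s m := eq_of_rel (.comm m n)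

@[simp]
theorem u_zero : u (0 : R) = 1 := by
  calc u (0 : R) = star (u 0) * u 0 * u 0 := by rw [star_u_mul_u, one_mul]
    _ = 1 := by rw [mul_assoc, u_mul_u, add_zero, star_u_mul_u]

@[simp]
theorem s_one : s (1 : R⁰) = 1 := by
  calc s (1 : R⁰) = star (s 1) * s 1 * s 1 := by rw [star_s_mul_s, one_mul]
    _ = 1 := by rw [mul_assoc, s_mul_s, one_mul, star_s_mul_s]

theorem star_u (n : R) : star (u n) = u (-n) := by
  calc star (u n) = star (u n) * (u n * u (-n)) := by
        rw [u_mul_u, add_neg_cancel, u_zero, mul_one]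
    _ = u (-n) := by rw [← mul_assoc, star_u_mul_u, one_mul]

theorem u_mul_star_s (m : R⁰) (n : R) : u n * star (s m) = star (s m) * u (m * n) := by
  have h := congrArg star (s_mul_u m (-n))
  rwa [star_mul, star_mul, star_u, star_u, mul_neg, neg_neg, neg_neg] at h

@[simp]
theorem e_one : e (1 : R⁰) = 1 := by rw [e, s_one, star_one, mul_one]

theorem isStarProjection_e (m : R⁰) : IsStarProjection (e m) where
  isIdempotentElem := by
    rw [IsIdempotentElem, e, mul_assoc, ← mul_assoc (star (s m)), star_s_mul_s, one_mul]
  isSelfAdjoint := .mul_star_self _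

theorem e_mul_s (m : R⁰) : e m * s m = s m := by rw [e, mul_assoc, star_s_mul_s, mul_one]

theorem star_s_mul_e (m : R⁰) : star (s m) * e m = star (s m) := by
  rw [e, ← mul_assoc, star_s_mul_s, one_mul]

theorem s_mul_e (k m : R⁰) : s k * e m = e (k * m) * s k := by
  rw [e, e, ← s_mul_s, star_mul]
  simp only [mul_assoc, star_s_mul_s, mul_one]

theorem u_mul_e (m : R⁰) (t : R) : u (m * t) * e m = e m * u (m * t) := by
  rw [e, ← mul_assoc, ← s_mul_u, mul_assoc, mul_assoc, u_mul_star_s]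

theorem coreWord_zero_zero (k : R⁰) : coreWord k 0 0 = e k := by
  rw [coreWord, u_zero, one_mul, mul_one]

theorem star_coreWord (k : R⁰) (a b : R) : star (coreWord k a b) = coreWord k (-b) (-a) := by
  simp only [coreWord, star_mul, star_u, (isStarProjection_e k).isSelfAdjoint.star_eq, mul_assoc]

theorem u_mul_coreWord (k : R⁰) (n a b : R) : u n * coreWord k a b = coreWord k (n + a) b := by
  rw [coreWord, coreWord, ← u_mul_u]
  simp only [mul_assoc]

theorem coreWord_mul_u (k : R⁰) (a b n : R) : coreWord k a b * u n = coreWord k a (b + n) := by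
  rw [coreWord, coreWord, ← u_mul_u]
  simp only [mul_assoc]

theorem s_mul_coreWord (l k : R⁰) (a b : R) :
    s l * coreWord k a b = coreWord (l * k) (l * a) (l * b) * s l := by
  rw [coreWord, coreWord, ← mul_assoc, ← mul_assoc, s_mul_u, mul_assoc _ (s l), s_mul_e,
    ← mul_assoc, mul_assoc _ (s l), s_mul_u, ← mul_assoc]

theorem coreWord_mul_add (k : R⁰) (t a b : R) :
    coreWord k (a + k * t) b = coreWord k a (k * t + b) := by
  rw [coreWord, coreWord, ← u_mul_u, ← u_mul_u, mul_assoc (u a), u_mul_e]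
  simp only [mul_assoc]

theorem coreWord_mul_coreWord_of_dvd {k : R⁰} {b c : R} (h : (k : R) ∣ b + c) (a d : R) :
    coreWord k a b * coreWord k c d = coreWord k (a + (b + c)) d := by
  obtain ⟨t, ht⟩ := h
  calc coreWord k a b * coreWord k c d = u a * (e k * u (b + c) * e k) * u d := by
        simp only [coreWord, ← u_mul_u, mul_assoc]
    _ = u a * (u (b + c) * e k) * u d := by
        rw [ht, ← u_mul_e, mul_assoc (u _) (e k), (isStarProjection_e k).isIdempotentElem.eq]
    _ = coreWord k (a + (b + c)) d := by simp only [coreWord, ← u_mul_u, mul_assoc]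

theorem isStarProjection_proj (k : R⁰) (n : R) : IsStarProjection (proj k n) where
  isIdempotentElem := by
    rw [IsIdempotentElem, coreWord_mul_coreWord_of_dvd (by simp), neg_add_cancel, add_zero]
  isSelfAdjoint := by rw [IsSelfAdjoint, star_coreWord, neg_neg]

theorem proj_congr {k : R⁰} {a b : R} (h : (k : R) ∣ a - b) : proj k a = proj k b := by
  obtain ⟨t, ht⟩ := h
  obtain rfl : a = b + k * t := by rw [← ht, add_sub_cancel]
  rw [proj, coreWord_mul_add]
  congr 1
  ring

theorem proj_out_mk (k : R⁰) (a : R) :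
    proj k (Ideal.Quotient.mk (Ideal.span {(k : R)}) a).out = proj k a := by
  refine proj_congr ?_
  rw [← Ideal.mem_span_singleton, ← Ideal.Quotient.eq]
  exact Quotient.out_eq _

theorem sum_proj (k : R⁰) : ∑ c : R ⧸ Ideal.span {(k : R)}, proj k c.out = 1 := by
  rw [← finsum_eq_sum_of_fintype]
  exact eq_of_rel (.partition k)

/-- Compressing `∑ p k = 1` by `p j` shows that the positive elements `p j * p k * p j` with
`k ≠ j` add up to zero. -/
theorem mul_eq_zero_of_sum_isStarProjection_eq_one {A ι : Type*} [CStarAlgebra A] [Fintype ι]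
    {p : ι → A} (hp : ∀ i, IsStarProjection (p i)) (hsum : ∑ i, p i = 1) {i j : ι}
    (hij : i ≠ j) : p i * p j = 0 := by
  classical
  let _ := CStarAlgebra.spectralOrder A
  let _ := CStarAlgebra.spectralOrderedRing A
  have star_mul_self (k : ι) : star (p k * p j) * (p k * p j) = p j * p k * p j := by
    rw [star_mul, (hp k).isSelfAdjoint.star_eq, (hp j).isSelfAdjoint.star_eq, mul_assoc,
      ← mul_assoc (p k), (hp k).isIdempotentElem.eq, mul_assoc]
  have sum_erase : ∑ k ∈ Finset.univ.erase j, star (p k * p j) * (p k * p j) = 0 := by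
    have h : ∑ k, p j * p k * p j = p j := by
      rw [← Finset.sum_mul, ← Finset.mul_sum, hsum, mul_one, (hp j).isIdempotentElem.eq]
    rw [← Finset.add_sum_erase _ _ (Finset.mem_univ j), (hp j).isIdempotentElem.eq,
      (hp j).isIdempotentElem.eq, add_eq_left] at h
    simpa only [star_mul_self] using h
  exact CStarRing.star_mul_self_eq_zero_iff _ |>.1 <|
    (Finset.sum_eq_zero_iff_of_nonneg fun k _ => star_mul_self_nonneg (p k * p j)).1 sum_erase i
      (by simpa using hij)

theorem proj_mul_proj_of_not_dvd {k : R⁰} {a b : R} (h : ¬ (k : R) ∣ a - b) :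
    proj k a * proj k b = 0 := by
  rw [← proj_out_mk k a, ← proj_out_mk k b]
  refine mul_eq_zero_of_sum_isStarProjection_eq_one
    (p := fun c : R ⧸ Ideal.span {(k : R)} => proj k c.out)
    (fun _ => isStarProjection_proj _ _) (sum_proj k) ?_
  rwa [Ne, Ideal.Quotient.eq, Ideal.mem_span_singleton]

theorem coreWord_mul_coreWord_of_not_dvd {k : R⁰} {b c : R} (h : ¬ (k : R) ∣ b + c) (a d : R) :
    coreWord k a b * coreWord k c d = 0 := by
  have hl : coreWord k a b = u (a + b) * proj k (-b) := by
    rw [u_mul_coreWord, neg_neg, add_neg_cancel_right]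
  have hr : coreWord k c d = proj k c * u (c + d) := by
    rw [coreWord_mul_u, neg_add_cancel_left]
  rw [hl, hr, mul_assoc, ← mul_assoc (proj k (-b)),
    proj_mul_proj_of_not_dvd (by rwa [← neg_add', dvd_neg]), zero_mul, mul_zero]

theorem s_mul_coreWord_mul_star_s (l k : R⁰) (a b : R) :
    s l * coreWord k a b * star (s l) = coreWord (l * k) (l * a) (l * b) := by
  calc s l * coreWord k a b * star (s l) = s l * u a * e k * (u b * star (s l)) := by
        simp only [coreWord, mul_assoc]
    _ = u (l * a) * (s l * e k * star (s l)) * u (l * b) := by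
        rw [s_mul_u, u_mul_star_s]
        simp only [mul_assoc]
    _ = coreWord (l * k) (l * a) (l * b) := by
        rw [coreWord, e, e, ← s_mul_s, star_mul]
        simp only [mul_assoc]

theorem e_eq_sum_proj (k m : R⁰) :
    e k = ∑ c : R ⧸ Ideal.span {(m : R)}, proj (k * m) (k * c.out) := by
  calc e k = s k * (∑ c : R ⧸ Ideal.span {(m : R)}, proj m c.out) * star (s k) := by
        rw [sum_proj, mul_one, e]
    _ = ∑ c : R ⧸ Ideal.span {(m : R)}, proj (k * m) (k * c.out) := by
        simp only [Finset.mul_sum, Finset.sum_mul, s_mul_coreWord_mul_star_s, mul_neg]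

theorem coreWord_eq_sum (k m : R⁰) (a b : R) : coreWord k a b =
    ∑ c : R ⧸ Ideal.span {(m : R)}, coreWord (k * m) (a + k * c.out) (-(k * c.out) + b) := by
  rw [coreWord, e_eq_sum_proj k m]
  simp only [Finset.mul_sum, Finset.sum_mul, u_mul_coreWord, coreWord_mul_u]

theorem commute_proj_of_same (k : R⁰) (a b : R) : Commute (proj k a) (proj k b) := by
  by_cases h : (k : R) ∣ a - b
  · rw [proj_congr h]
  · rw [Commute, SemiconjBy, proj_mul_proj_of_not_dvd h,
      proj_mul_proj_of_not_dvd (by rwa [dvd_sub_comm])]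

theorem commute_proj (k m : R⁰) (a b : R) : Commute (proj k a) (proj m b) := by
  rw [proj, proj, coreWord_eq_sum k m, coreWord_eq_sum m k, mul_comm m k]
  refine Commute.sum_left _ _ _ fun c _ => Commute.sum_right _ _ _ fun d _ => ?_
  simpa only [proj, neg_add_rev] using commute_proj_of_same (k * m) (a + k * c.out) (b + m * d.out)

theorem diagAlg_mul_comm : ∀ x ∈ diagAlg R, ∀ y ∈ diagAlg R, x * y = y * x := by
  have commute_of_mem : ∀ x ∈ projSet R, ∀ y ∈ projSet R, x * y = y * x := by
    rintro _ ⟨k, a, rfl⟩ _ ⟨m, b, rfl⟩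
    exact commute_proj k m a b
  have star_of_mem : ∀ x ∈ projSet R, star x = x := by
    rintro _ ⟨k, a, rfl⟩
    exact (isStarProjection_proj k a).isSelfAdjoint
  have isMulCommutative : IsMulCommutative (StarAlgebra.adjoin ℂ (projSet R)) :=
    StarAlgebra.isMulCommutative_adjoin ℂ commute_of_mem
      fun x hx y hy => by rw [star_of_mem y hy, commute_of_mem x hx y hy]
  let : CommRing (StarAlgebra.adjoin ℂ (projSet R)).topologicalClosure :=
    StarSubalgebra.commRingTopologicalClosure _ (isMulCommutative_iff.1 isMulCommutative)
  intro x hx y hy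
  exact congrArg Subtype.val
    (mul_comm (G := (StarAlgebra.adjoin ℂ (projSet R)).topologicalClosure) ⟨x, hx⟩ ⟨y, hy⟩)

theorem coreWord_mul_coreWord_mem_coreSpan (j k : R⁰) (a b c d : R) :
    coreWord j a b * coreWord k c d ∈ coreSpan R := by
  have same (l : R⁰) (a b c d : R) : coreWord l a b * coreWord l c d ∈ coreSpan R := by
    by_cases h : (l : R) ∣ b + c
    · rw [coreWord_mul_coreWord_of_dvd h]
      exact coreWord_mem_coreSpan _ _ _
    · rw [coreWord_mul_coreWord_of_not_dvd h]
      exact zero_mem _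
  rw [coreWord_eq_sum j k, coreWord_eq_sum k j, mul_comm k j, Finset.sum_mul_sum]
  exact sum_mem fun _ _ => sum_mem fun _ _ => same _ _ _ _ _

theorem u_mul_word (n : R) (m k : R⁰) (a b : R) (m' : R⁰) :
    u n * word m k a b m' = word m k (m * n + a) b m' := by
  rw [word, word, ← mul_assoc, ← mul_assoc, u_mul_star_s, mul_assoc _ (u _), u_mul_coreWord]

theorem star_s_mul_word (l m k : R⁰) (a b : R) (m' : R⁰) :
    star (s l) * word m k a b m' = word (l * m) k a b m' := by
  rw [word, word, ← mul_assoc, ← mul_assoc, star_s_mul_star_s]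

theorem s_mul_star_s (l m : R⁰) : s l * star (s m) = star (s m) * e (m * l) * s l := by
  calc s l * star (s m) = star (s m) * (s m * s l) * star (s m) := by
        rw [← mul_assoc, star_s_mul_s, one_mul]
    _ = star (s m) * (s l * e m) := by
        rw [s_mul_s, mul_comm m l, ← s_mul_s, e]
        simp only [mul_assoc]
    _ = star (s m) * e (m * l) * s l := by rw [s_mul_e, mul_comm l m, mul_assoc]

theorem s_mul_word (l m k : R⁰) (a b : R) (m' : R⁰) : s l * word m k a b m' =
    star (s m) * (coreWord (m * l) 0 0 * coreWord (l * k) (l * a) (l * b)) * s (l * m') := by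
  rw [word, ← mul_assoc, ← mul_assoc, s_mul_star_s, mul_assoc _ (s l), s_mul_coreWord,
    coreWord_zero_zero, ← s_mul_s]
  simp only [mul_assoc]

theorem ofPre_letter_mul_mem_wordSpan (x : R⁰ ⊕ R) (b : Bool) {y : Alg R}
    (hy : y ∈ wordSpan R) : ofPre (FreeStarAlg.letter x b) * y ∈ wordSpan R := by
  refine mul_mem_wordSpan (fun m k a c m' => ?_) hy
  rcases x with l | n <;> cases b
  · change s l * word m k a c m' ∈ wordSpan R
    rw [s_mul_word]
    exact star_s_mul_mul_s_mem_wordSpan (coreWord_mul_coreWord_mem_coreSpan _ _ _ _ _ _) _ _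
  · rw [FreeStarAlg.letter_true, ← star_ofPre]
    change star (s l) * word m k a c m' ∈ wordSpan R
    rw [star_s_mul_word]
    exact word_mem_wordSpan _ _ _ _ _
  · change u n * word m k a c m' ∈ wordSpan R
    rw [u_mul_word]
    exact word_mem_wordSpan _ _ _ _ _
  · rw [FreeStarAlg.letter_true, ← star_ofPre]
    change star (u n) * word m k a c m' ∈ wordSpan R
    rw [star_u, u_mul_word]
    exact word_mem_wordSpan _ _ _ _ _

theorem ofPre_mem_wordSpan (p : Pre R) : ofPre p ∈ wordSpan R := by
  suffices h : ∀ x ∈ wordSpan R, ofPre p * x ∈ wordSpan R by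
    have one_mem : 1 ∈ wordSpan R := by
      simpa [word, coreWord] using word_mem_wordSpan (1 : R⁰) 1 0 0 1
    simpa only [mul_one] using h 1 one_mem
  induction p using FreeStarAlg.induction_on with
  | h_scalar c =>
    intro x hx
    rw [Algebra.algebraMap_eq_smul_one, ofPre_smul, map_one, smul_mul_assoc, one_mul]
    exact Submodule.smul_mem _ _ hx
  | h_letter x b => exact fun y => ofPre_letter_mul_mem_wordSpan x b
  | h_add p q hp hq =>
    intro x hx
    rw [map_add, add_mul]
    exact add_mem (hp x hx) (hq x hx)
  | h_mul p q hp hq =>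
    intro x hx
    rw [map_mul, mul_assoc]
    exact hp _ (hq x hx)

theorem dense_wordSpan : Dense (wordSpan R : Set (Alg R)) :=
  denseRange_ofPre.mono (Set.range_subset_iff.2 ofPre_mem_wordSpan)

theorem mem_of_forall_word_mem {S : Submodule ℂ (Alg R)} (hS : IsClosed (S : Set (Alg R)))
    (h : ∀ (m k : R⁰) (a b : R) (m' : R⁰), word m k a b m' ∈ S) (x : Alg R) : x ∈ S := by
  have wordSpan_le : wordSpan R ≤ S := by
    refine Submodule.span_le.2 ?_
    rintro _ ⟨m, k, a, b, m', rfl⟩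
    exact h m k a b m'
  exact hS.closure_subset_iff.2 wordSpan_le (dense_wordSpan x)

theorem ext_of_word {E : Type*} [NormedAddCommGroup E] [NormedSpace ℂ E] {f g : Alg R →L[ℂ] E}
    (h : ∀ (m k : R⁰) (a b : R) (m' : R⁰), f (word m k a b m') = g (word m k a b m')) : f = g := by
  ext x
  exact mem_of_forall_word_mem (S := LinearMap.eqLocus (f : Alg R →ₗ[ℂ] E) (g : Alg R →ₗ[ℂ] E))
    (isClosed_eq f.continuous g.continuous) h x

theorem word_coreWord (m k : R⁰) (a b : R) :
    word m (m * k) (m * a) (m * b) m = coreWord k a b := by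
  rw [word, mul_assoc, ← s_mul_coreWord, ← mul_assoc, star_s_mul_s, one_mul]

theorem star_s_mul_u_mul_s_of_not_dvd {m : R⁰} {n : R} (h : ¬ (m : R) ∣ n) :
    star (s m) * u n * s m = 0 := by
  calc star (s m) * u n * s m = star (s m) * e m * u n * (e m * s m) := by
        rw [star_s_mul_e, e_mul_s]
    _ = star (s m) * (coreWord m 0 n * coreWord m 0 0) * s m := by
        simp only [coreWord, u_zero, one_mul, mul_one, mul_assoc]
    _ = 0 := by
        rw [coreWord_mul_coreWord_of_not_dvd (by rwa [add_zero]), mul_zero, zero_mul]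

theorem word_eq_zero_of_not_dvd {m k : R⁰} {a b : R} (h : ¬ ((m : R) ∣ a ∧ (m : R) ∣ b)) :
    word m (m * k) a b m = 0 := by
  have factor : word m (m * k) a b m =
      star (s m) * u a * s m * e k * (star (s m) * u b * s m) := by
    rw [word, coreWord, e, ← s_mul_s, star_mul, e]
    simp only [mul_assoc]
  rw [factor]
  by_cases ha : (m : R) ∣ a
  · rw [star_s_mul_u_mul_s_of_not_dvd fun hb => h ⟨ha, hb⟩, mul_zero]
  · rw [star_s_mul_u_mul_s_of_not_dvd ha, zero_mul, zero_mul]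

/-- After splitting `e_k` below `e_{km}`, each summand `u^x e_{km} u^y` is either compressed to
zero or to a core word, according to whether `m` divides both `x` and `y`. -/
theorem word_self_mem {S : Submodule ℂ (Alg R)} {m k : R⁰} {a b : R}
    (h : ∀ x y : R, m * (x + y) = a + b → coreWord k x y ∈ S) : word m k a b m ∈ S := by
  rw [word, coreWord_eq_sum k m, mul_comm k m, Finset.mul_sum, Finset.sum_mul]
  refine Submodule.sum_mem _ fun c _ => ?_
  rw [← word]
  by_cases hdvd : (m : R) ∣ a + k * c.out ∧ (m : R) ∣ -(k * c.out) + b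
  · obtain ⟨⟨x, hx⟩, y, hy⟩ := hdvd
    rw [hx, hy, word_coreWord]
    refine h x y ?_
    rw [mul_add, ← hx, ← hy]
    abel
  · rw [word_eq_zero_of_not_dvd hdvd]
    exact zero_mem _

end Relations

/-! ### Characters of discrete groups -/

section Characters

open MeasureTheory

variable {G : Type*} [CommGroup G]

/-- The homomorphism `ℚ / ℤ → ℝ / ℤ`, used to turn `ℚ / ℤ`-valued characters into
circle-valued ones. -/
def ratAddCircle : AddCircle (1 : ℚ) →+ AddCircle (1 : ℝ) :=
  QuotientAddGroup.map _ _ (Rat.castHom ℝ).toAddMonoidHom (by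
    rw [AddSubgroup.zmultiples_le, AddSubgroup.mem_comap]
    exact AddSubgroup.mem_zmultiples_iff.2 ⟨1, by simp⟩)

theorem ratAddCircle_injective : Function.Injective ratAddCircle := by
  rw [injective_iff_map_eq_zero]
  intro x hx
  induction x using QuotientAddGroup.induction_on with
  | H q =>
    have h : ((q : ℝ) : AddCircle (1 : ℝ)) = 0 := hx
    obtain ⟨n, hn⟩ := (AddCircle.coe_eq_zero_iff 1).1 h
    refine (AddCircle.coe_eq_zero_iff 1).2 ⟨n, ?_⟩
    simp only [zsmul_eq_mul, mul_one] at hn ⊢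
    exact_mod_cast hn

namespace Dual

/-- The character of the discrete group `G` given by a homomorphism to the circle. -/
def ofHom (f : G →* Circle) : Dual G :=
  ⟨(f : Disc G →* Circle), continuous_of_discreteTopology⟩

theorem exists_val_ne_one {g : G} (hg : g ≠ 1) : ∃ χ : Dual G, χ.val g ≠ 1 := by
  obtain ⟨c, hc⟩ := CharacterModule.exists_character_apply_ne_zero_of_ne_zero
    (A := Additive G) (a := Additive.ofMul g) (by simpa using hg)
  let f : G →* Circle :=
    { toFun := fun x => AddCircle.toCircle (ratAddCircle (c (Additive.ofMul x)))
      map_one' := by simp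
      map_mul' := fun x y => by rw [ofMul_mul, map_add, map_add, AddCircle.toCircle_add] }
  refine ⟨ofHom f, fun h => hc (ratAddCircle_injective ?_)⟩
  refine AddCircle.injective_toCircle one_ne_zero ?_
  rw [map_zero, AddCircle.toCircle_zero]
  exact Circle.coe_eq_one.1 h

@[simp]
theorem one_val (g : G) : (1 : Dual G).val g = 1 := rfl

@[simp]
theorem val_one (χ : Dual G) : χ.val 1 = 1 := Circle.coe_eq_one.2 (map_one χ)

theorem mul_val (χ ψ : Dual G) (g : G) : (χ * ψ).val g = χ.val g * ψ.val g := rfl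

theorem val_mul (χ : Dual G) (g h : G) : χ.val (g * h) = χ.val g * χ.val h :=
  congrArg Subtype.val (map_mul χ (show Disc G from g) (show Disc G from h))

theorem star_val (χ : Dual G) (g : G) : star (χ.val g) = χ.val g⁻¹ :=
  (Circle.coe_inv_eq_conj _).symm.trans
    (congrArg Subtype.val (map_inv χ (show Disc G from g)).symm)

theorem star_val_mul_val (χ : Dual G) (g : G) : star (χ.val g) * χ.val g = 1 := by
  rw [star_val, ← val_mul, inv_mul_cancel, val_one]

theorem continuous_val (g : G) : Continuous fun χ : Dual G => χ.val g :=
  continuous_subtype_val.comp <| (ContinuousEvalConst.continuous_eval_const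
    (F := C(Disc G, Circle)) (show Disc G from g)).comp
      (ContinuousMonoidHom.isInducing_toContinuousMap (Disc G) Circle).continuous

theorem val_injective : Function.Injective (val : Dual G → G → ℂ) := fun _ _ h =>
  PontryaginDual.ext fun g => Circle.ext (congrFun h g)

variable (G) in
/-- The elements of `G` as continuous functions on the dual group. -/
def evalHom : G →* C(Dual G, ℂ) where
  toFun g := ⟨fun χ => χ.val g, continuous_val g⟩
  map_one' := by ext χ; exact val_one χ
  map_mul' g h := by ext χ; exact val_mul χ g h

/-- Evaluations are closed under products and adjoints and separate characters, so this is the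
Stone–Weierstrass theorem. -/
theorem topologicalClosure_span_range_evalHom :
    (Submodule.span ℂ (Set.range (evalHom G))).topologicalClosure = ⊤ := by
  have star_evalHom (g : G) : star (evalHom G g) = evalHom G g⁻¹ := by
    ext χ
    exact χ.star_val g
  have span_eq : Submodule.span ℂ (Set.range (evalHom G)) =
      (Algebra.adjoin ℂ (Set.range (evalHom G))).toSubmodule := by
    rw [Algebra.adjoin_eq_span, ← MonoidHom.coe_mrange, Submonoid.closure_eq]
  let S : StarSubalgebra ℂ C(Dual G, ℂ) :=
    { Algebra.adjoin ℂ (Set.range (evalHom G)) with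
      star_mem' := by
        change Algebra.adjoin ℂ (Set.range (evalHom G)) ≤
          star (Algebra.adjoin ℂ (Set.range (evalHom G)))
        refine Algebra.adjoin_le ?_
        rintro _ ⟨g, rfl⟩
        exact Algebra.subset_adjoin ⟨g⁻¹, (star_evalHom g).symm⟩ }
  have separates : S.SeparatesPoints := by
    intro χ ψ hne
    obtain ⟨g, hg⟩ := Function.ne_iff.1 (val_injective.ne hne)
    exact ⟨_, ⟨evalHom G g, Algebra.subset_adjoin ⟨g, rfl⟩, rfl⟩, hg⟩
  rw [span_eq]
  exact congrArg (fun T : StarSubalgebra ℂ C(Dual G, ℂ) => T.toSubalgebra.toSubmodule)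
    (ContinuousMap.starSubalgebra_topologicalClosure_eq_top_of_separatesPoints S separates)

end Dual

instance : IsProbabilityMeasure (dualHaar G) := ⟨Measure.haarMeasure_self⟩

instance : (dualHaar G).IsHaarMeasure := Measure.isHaarMeasure_haarMeasure _

theorem integral_mul_val_eq_zero {F : Dual G → ℂ} {g : G} {σ : Dual G} (hσ : σ.val g ≠ 1)
    (hF : ∀ χ, F (σ * χ) = F χ) : ∫ χ, F χ * χ.val g ∂(dualHaar G) = 0 := by
  have translate : σ.val g * ∫ χ, F χ * χ.val g ∂(dualHaar G) =
      ∫ χ, F χ * χ.val g ∂(dualHaar G) :=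
    calc σ.val g * ∫ χ, F χ * χ.val g ∂(dualHaar G)
        = ∫ χ, F (σ * χ) * (σ * χ).val g ∂(dualHaar G) := by
          simp only [hF, Dual.mul_val, mul_left_comm _ (σ.val g), integral_const_mul]
      _ = ∫ χ, F χ * χ.val g ∂(dualHaar G) :=
          integral_mul_left_eq_self (fun χ => F χ * χ.val g) σ
  exact (mul_left_eq_self₀.1 translate).resolve_left hσ

theorem integral_val (g : G) : ∫ χ, χ.val g ∂(dualHaar G) = delta g 1 := by
  by_cases hg : g = 1
  · simp [hg, delta]
  · obtain ⟨σ, hσ⟩ := Dual.exists_val_ne_one hg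
    rw [delta, if_neg hg]
    simpa only [one_mul] using
      integral_mul_val_eq_zero (F := fun _ : Dual G => 1) hσ fun _ => rfl

theorem eq_zero_of_forall_integral_val_mul_star_eq_zero {F : C(Dual G, ℂ)}
    (hF : ∀ g, ∫ χ, χ.val g * star (F χ) ∂(dualHaar G) = 0) : F = 0 := by
  let toL2 := ContinuousMap.toLp 2 (dualHaar G) ℂ (E := ℂ)
  let innerF : C(Dual G, ℂ) →L[ℂ] ℂ := (innerSL ℂ (toL2 F)).comp toL2
  have span_le_ker : Submodule.span ℂ (Set.range (Dual.evalHom G)) ≤ innerF.ker := by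
    rw [Submodule.span_le]
    rintro _ ⟨g, rfl⟩
    exact (ContinuousMap.inner_toLp (dualHaar G) F _).trans (hF g)
  have ker_eq_top : innerF.ker = ⊤ := by
    rw [eq_top_iff, ← Dual.topologicalClosure_span_range_evalHom]
    exact Submodule.topologicalClosure_minimal _ span_le_ker innerF.isClosed_ker
  have inner_self : inner ℂ (toL2 F) (toL2 F) = 0 :=
    LinearMap.mem_ker.1 (ker_eq_top ▸ Submodule.mem_top : F ∈ innerF.ker)
  exact ContinuousMap.toLp_injective (dualHaar G) ((inner_self_eq_zero.1 inner_self).trans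
    (map_zero toL2).symm)

theorem integrable_of_continuous {K E : Type*} [TopologicalSpace K] [CompactSpace K]
    [MeasurableSpace K] [BorelSpace K] [NormedAddCommGroup E] {μ : Measure K}
    [IsFiniteMeasure μ] {f : K → E} (hf : Continuous f) : Integrable f μ :=
  hf.integrable_of_hasCompactSupport (HasCompactSupport.of_compactSpace f)

/-- The Fourier coefficients of `F` at all nontrivial elements vanish. -/
theorem Dual.eq_of_forall_translation_invariant {F : Dual G → ℂ} (hF : Continuous F)
    (hinv : ∀ g ≠ 1, ∃ σ : Dual G, σ.val g ≠ 1 ∧ ∀ χ, F (σ * χ) = F χ) (χ ψ : Dual G) :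
    F χ = F ψ := by
  let mean := ∫ χ, F χ ∂(dualHaar G)
  let F₀ : C(Dual G, ℂ) := ⟨fun χ => F χ - mean, hF.sub continuous_const⟩
  have integral_F₀ : ∫ χ, F₀ χ ∂(dualHaar G) = 0 := by
    simp only [F₀, ContinuousMap.coe_mk]
    rw [integral_sub (integrable_of_continuous hF) (integrable_const _), integral_const,
      probReal_univ, one_smul, sub_self]
  have F₀_eq_zero : F₀ = 0 := by
    refine eq_zero_of_forall_integral_val_mul_star_eq_zero fun g => ?_
    by_cases hg : g = 1
    · simp only [hg, val_one, one_mul, Complex.star_def]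
      rw [integral_conj, integral_F₀, map_zero]
    · obtain ⟨σ, hσ, hσF⟩ := hinv g hg
      simp only [mul_comm (val _ g)]
      exact integral_mul_val_eq_zero hσ fun χ => by simp [F₀, hσF]
  have F_eq_mean (χ : Dual G) : F χ = mean := sub_eq_zero.1 (DFunLike.congr_fun F₀_eq_zero χ)
  rw [F_eq_mean, F_eq_mean]

end Characters

/-! ### Homomorphisms from the free *-algebra and their extensions -/

section Extension

theorem FreeStarAlg.hom_ext {X B : Type*} [Semiring B] [Algebra ℂ B] [Star B]
    {f g : FreeStarAlg X →⋆ₐ[ℂ] B} (h : ∀ x, f (gen x) = g (gen x)) : f = g := by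
  ext a
  induction a using FreeStarAlg.induction_on with
  | h_scalar c => rw [AlgHomClass.commutes, AlgHomClass.commutes]
  | h_letter x b =>
    cases b with
    | false => exact h x
    | true => rw [letter_true, map_star, map_star, h x]
  | h_add a b ha hb => rw [map_add, map_add, ha, hb]
  | h_mul a b ha hb => rw [map_mul, map_mul, ha, hb]

/-- The continuous extension of the `*`-homomorphism `f` along the `*`-homomorphism `j` with dense
range. -/
def extendStarAlgHom {F A B : Type*} [Ring F] [StarRing F] [Algebra ℂ F] [CStarAlgebra A]
    [CStarAlgebra B] (j : F →⋆ₐ[ℂ] A) (f : F →⋆ₐ[ℂ] B) (hj : DenseRange j)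
    (hf : ∀ x, ‖f x‖ ≤ ‖j x‖) : A →⋆ₐ[ℂ] B :=
  let ext : A →L[ℂ] B := (f : F →ₗ[ℂ] B).extendOfNorm (j : F →ₗ[ℂ] A)
  have ext_apply (x : F) : ext (j x) = f x :=
    LinearMap.extendOfNorm_eq hj ⟨1, fun x => (hf x).trans_eq (one_mul _).symm⟩ x
  { toFun := ext
    map_one' := by rw [← map_one j, ext_apply, map_one]
    map_zero' := map_zero ext
    map_add' := map_add ext
    map_mul' := hj.induction_on₂ (isClosed_eq (by fun_prop) (by fun_prop)) fun x y => by
      rw [← map_mul, ext_apply, ext_apply, ext_apply, map_mul]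
    commutes' c := by rw [← AlgHomClass.commutes j, ext_apply, AlgHomClass.commutes]
    map_star' x := hj.induction_on x (isClosed_eq (by fun_prop) (by fun_prop)) fun x => by
      rw [← map_star, ext_apply, ext_apply, map_star] }

@[simp]
theorem extendStarAlgHom_apply {F A B : Type*} [Ring F] [StarRing F] [Algebra ℂ F]
    [CStarAlgebra A] [CStarAlgebra B] {j : F →⋆ₐ[ℂ] A} {f : F →⋆ₐ[ℂ] B} (hj : DenseRange j)
    (hf : ∀ x, ‖f x‖ ≤ ‖j x‖) (x : F) : extendStarAlgHom j f hj hf (j x) = f x :=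
  LinearMap.extendOfNorm_eq hj ⟨1, fun x => (hf x).trans_eq (one_mul _).symm⟩ x

variable {R A B : Type*} [CommRing R] [CStarAlgebra A] [CStarAlgebra B]

/-- Evaluation of the free `*`-algebra at elements of a C*-algebra, as a `*`-homomorphism. -/
def evalHom (a : R⁰ → A) (b : R → A) : Pre R →⋆ₐ[ℂ] A :=
  { evalPre a b with map_star' := evalPre_star a b }

variable {a : R⁰ → A} {b : R → A}

@[simp]
theorem evalHom_preS (m : R⁰) : evalHom a b (preS m) = a m := evalPre_letter a b (Sum.inl m) false

@[simp]
theorem evalHom_preU (n : R) : evalHom a b (preU n) = b n := evalPre_letter a b (Sum.inr n) false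

theorem hom_eq_evalHom (f : Pre R →⋆ₐ[ℂ] A) :
    f = evalHom (fun m => f (preS m)) (fun n => f (preU n)) :=
  FreeStarAlg.hom_ext <| by
    let a (m : R⁰) := f (preS m)
    let b (n : R) := f (preU n)
    rintro (m | n)
    · exact (evalHom_preS (a := a) (b := b) m).symm
    · exact (evalHom_preU (a := a) (b := b) n).symm

theorem comp_evalHom (f : A →⋆ₐ[ℂ] B) :
    f.comp (evalHom a b) = evalHom (fun m => f (a m)) (fun n => f (b n)) := by
  simpa using hom_eq_evalHom (f.comp (evalHom a b))

theorem evalHom_s_u (x : Pre R) : evalHom s u x = ofPre x := by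
  let ofPreHom : Pre R →⋆ₐ[ℂ] Alg R :=
    { ofPre with
      commutes' c := by
        change ofPre (algebraMap ℂ (Pre R) c) = _
        rw [Algebra.algebraMap_eq_smul_one, ofPre_smul, map_one, Algebra.algebraMap_eq_smul_one]
      map_star' x := (star_ofPre x).symm }
  exact (DFunLike.congr_fun (hom_eq_evalHom ofPreHom) x).symm

theorem denseRange_evalHom_s_u : DenseRange (evalHom (R := R) s u) := by
  simpa only [DenseRange, funext evalHom_s_u] using denseRange_ofPre

open scoped CStarAlgebra in
theorem starAlgHom_ext_of_denseRange_evalHom (hdense : DenseRange (evalHom a b))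
    {f g : A →⋆ₐ[ℂ] B} (ha : ∀ m, f (a m) = g (a m)) (hb : ∀ n, f (b n) = g (b n)) : f = g := by
  have comp_eq : f.comp (evalHom a b) = g.comp (evalHom a b) := by
    simp only [comp_evalHom, ha, hb]
  exact DFunLike.coe_injective <| hdense.equalizer (map_continuous f) (map_continuous g)
    (congrArg DFunLike.coe comp_eq)

theorem continuous_evalHom {X : Type*} [TopologicalSpace X] {a : X → R⁰ → A} {b : X → R → A}
    (ha : ∀ m, Continuous fun x => a x m) (hb : ∀ n, Continuous fun x => b x n) (p : Pre R) :
    Continuous fun x => evalHom (a x) (b x) p := by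
  have continuous_gen (y : R⁰ ⊕ R) :
      Continuous fun x => evalHom (a x) (b x) (FreeStarAlg.gen y) := by
    rcases y with m | n
    · exact (ha m).congr fun x => (evalHom_preS m).symm
    · exact (hb n).congr fun x => (evalHom_preU n).symm
  induction p using FreeStarAlg.induction_on with
  | h_scalar c => simpa only [AlgHomClass.commutes] using continuous_const
  | h_letter y d =>
    cases d with
    | false => exact continuous_gen y
    | true => simpa only [FreeStarAlg.letter_true, map_star] using (continuous_gen y).star
  | h_add p q hp hq => simp only [map_add]; exact hp.add hq
  | h_mul p q hp hq => simp only [map_mul]; exact hp.mul hq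

end Extension

/-! ### Actions of dual groups -/

section DualAction

theorem continuous_apply_of_dense {X A B : Type*} [TopologicalSpace X] [CStarAlgebra A]
    [CStarAlgebra B] (f : X → A →⋆ₐ[ℂ] B) {D : Set A} (hD : Dense D)
    (h : ∀ a ∈ D, Continuous fun x => f x a) (a : A) : Continuous fun x => f x a := by
  refine continuous_of_uniform_approx_of_continuous fun U hU => ?_
  obtain ⟨ε, ε_pos, ball_subset⟩ := Metric.mem_uniformity_dist.1 hU
  obtain ⟨b, hbD, hb⟩ := hD.exists_dist_lt a ε_pos
  refine ⟨fun x => f x b, h b hbD, fun x => ball_subset ?_⟩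
  calc dist (f x a) (f x b) = ‖f x (a - b)‖ := by rw [dist_eq_norm, map_sub]
    _ ≤ ‖a - b‖ := NonUnitalStarAlgHom.norm_apply_le (f x) _
    _ < ε := by rwa [← dist_eq_norm]

/-- An action of a group by `*`-endomorphisms, as an action by `*`-automorphisms. -/
def starAlgEquivOfHom {G A : Type*} [Group G] [Semiring A] [Algebra ℂ A] [Star A]
    (f : G →* (A →⋆ₐ[ℂ] A)) : G →* (A ≃⋆ₐ[ℂ] A) where
  toFun g := StarAlgEquiv.ofStarAlgHom (f g) (f g⁻¹)
    ((map_mul f g⁻¹ g).symm.trans (by rw [inv_mul_cancel, map_one]; rfl))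
    ((map_mul f g g⁻¹).symm.trans (by rw [mul_inv_cancel, map_one]; rfl))
  map_one' := by ext x; exact DFunLike.congr_fun (map_one f) x
  map_mul' g h := by ext x; exact DFunLike.congr_fun (map_mul f g h) x

variable {R A G : Type*} [CommRing R] [CStarAlgebra A] [CommGroup G]

/-- Evaluation of the free `*`-algebra at the family `a`, `b`, rescaled by the values of a
character at the degrees `v`, `w` of its members. -/
def twistedEvalHom (a : R⁰ → A) (b : R → A) (v : R⁰ → G) (w : R → G) (χ : Dual G) :
    Pre R →⋆ₐ[ℂ] A :=
  evalHom (fun m => χ.val (v m) • a m) (fun n => χ.val (w n) • b n)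

theorem continuous_twistedEvalHom (a : R⁰ → A) (b : R → A) (v : R⁰ → G) (w : R → G) (p : Pre R) :
    Continuous fun χ => twistedEvalHom a b v w χ p :=
  continuous_evalHom (fun m => (Dual.continuous_val (v m)).smul continuous_const)
    (fun n => (Dual.continuous_val (w n)).smul continuous_const) p

variable {a : R⁰ → A} {b : R → A} {v : R⁰ → G} {w : R → G} (hdense : DenseRange (evalHom a b))
  (hle : ∀ χ p, ‖twistedEvalHom a b v w χ p‖ ≤ ‖evalHom a b p‖)

/-- The endomorphism that rescales the generators `a`, `b` by the values of a character at their
degrees. -/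
def twist (χ : Dual G) : A →⋆ₐ[ℂ] A :=
  extendStarAlgHom (evalHom a b) (twistedEvalHom a b v w χ) hdense (hle χ)

theorem twist_evalHom (χ : Dual G) (p : Pre R) :
    twist hdense hle χ (evalHom a b p) = twistedEvalHom a b v w χ p :=
  extendStarAlgHom_apply hdense (hle χ) p

@[simp]
theorem twist_apply_left (χ : Dual G) (m : R⁰) :
    twist hdense hle χ (a m) = χ.val (v m) • a m := by
  simpa only [evalHom_preS, twistedEvalHom] using twist_evalHom hdense hle χ (preS m)

@[simp]
theorem twist_apply_right (χ : Dual G) (n : R) :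
    twist hdense hle χ (b n) = χ.val (w n) • b n := by
  simpa only [evalHom_preU, twistedEvalHom] using twist_evalHom hdense hle χ (preU n)

theorem twist_one : twist hdense hle 1 = StarAlgHom.id ℂ A :=
  starAlgHom_ext_of_denseRange_evalHom hdense (by simp) (by simp)

theorem twist_mul (χ ψ : Dual G) :
    twist hdense hle (χ * ψ) = (twist hdense hle χ).comp (twist hdense hle ψ) :=
  starAlgHom_ext_of_denseRange_evalHom hdense
    (by simp [Dual.mul_val, smul_smul, mul_comm]) (by simp [Dual.mul_val, smul_smul, mul_comm])

include hdense hle in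
theorem exists_dualAction :
    ∃ α : Dual G →* (A ≃⋆ₐ[ℂ] A), (∀ χ m, α χ (a m) = χ.val (v m) • a m) ∧
      (∀ χ n, α χ (b n) = χ.val (w n) • b n) ∧ ∀ x, Continuous fun χ => α χ x := by
  let action : Dual G →* (A →⋆ₐ[ℂ] A) :=
    { toFun := twist hdense hle
      map_one' := twist_one hdense hle
      map_mul' := twist_mul hdense hle }
  refine ⟨starAlgEquivOfHom action, twist_apply_left hdense hle, twist_apply_right hdense hle, ?_⟩
  refine continuous_apply_of_dense (twist hdense hle) hdense ?_
  rintro _ ⟨p, rfl⟩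
  simp only [twist_evalHom]
  exact continuous_twistedEvalHom a b v w p

end DualAction

/-! ### The action of the dual of `Q(R)^×` on `𝔄[R]` -/

section MulAction

variable {R : Type*} [CommRing R]

theorem toFrac_mul (k m : R⁰) : toFrac (k * m) = toFrac k * toFrac m :=
  Units.ext (map_mul (algebraMap R (FractionRing R)) (k : R) m)

theorem toFrac_injective : Function.Injective (toFrac : R⁰ → (FractionRing R)ˣ) := fun _ _ h =>
  Subtype.ext <| IsFractionRing.injective R (FractionRing R) <| congrArg Units.val h

variable [Ring.HasFiniteQuotients R] [Nontrivial R]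

theorem satisfies_val_toFrac_smul_s (φ : Dual (FractionRing R)ˣ) :
    Satisfies (fun m => φ.val (toFrac m) • s m) (u (R := R)) := by
  have smul_s_mul_star (m : R⁰) :
      φ.val (toFrac m) • s m * star (φ.val (toFrac m) • s m) = s m * star (s m) := by
    rw [star_smul, smul_mul_smul_comm, mul_comm, Dual.star_val_mul_val, one_smul]
  intro x y h
  cases h with
  | isometry m =>
    rw [star_smul, smul_mul_smul_comm, Dual.star_val_mul_val, one_smul, star_s_mul_s]
  | unitary_left n => exact eq_of_rel (.unitary_left n)
  | unitary_right n => exact eq_of_rel (.unitary_right n)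
  | mul k m => rw [smul_mul_smul_comm, s_mul_s, toFrac_mul, Dual.val_mul]
  | add l n => exact eq_of_rel (.add l n)
  | comm m n => rw [smul_mul_assoc, s_mul_u, mul_smul_comm]
  | partition m => simp only [smul_s_mul_star]; exact eq_of_rel (.partition m)

theorem exists_isMulDualAction :
    ∃ α : Dual (FractionRing R)ˣ →* (Alg R ≃⋆ₐ[ℂ] Alg R), IsMulDualAction α := by
  obtain ⟨α, apply_s, apply_u, hα⟩ := exists_dualAction (v := toFrac) (w := fun _ : R => 1)
    denseRange_evalHom_s_u fun φ p => by
      obtain ⟨π, ⟨map_s, map_u⟩, -⟩ :=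
        existsUnique_lift finite_quotient_span_singleton _ _ (satisfies_val_toFrac_smul_s φ)
      have comp_eq : π.comp (evalHom s u) = twistedEvalHom s u toFrac (fun _ => 1) φ := by
        simp only [comp_evalHom, map_s, map_u, twistedEvalHom, Dual.val_one, one_smul]
      rw [← comp_eq]
      exact NonUnitalStarAlgHom.norm_apply_le π _
  exact ⟨α, apply_s, fun φ n => by rw [apply_u, Dual.val_one, one_smul], hα⟩

end MulAction

/-! ### Unitaries in `𝔇[R]` implementing characters of finite quotients -/

section CharUnitary

open Multiplicative (ofAdd)

theorem sum_smul_mul_sum_smul {A ι : Type*} [CStarAlgebra A] [Fintype ι] {p : ι → A}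
    (hp : ∀ i, IsStarProjection (p i)) (hsum : ∑ i, p i = 1) (z w : ι → ℂ) :
    (∑ i, z i • p i) * ∑ i, w i • p i = ∑ i, (z i * w i) • p i := by
  rw [Finset.sum_mul]
  refine Finset.sum_congr rfl fun i _ => ?_
  rw [Finset.mul_sum, Finset.sum_eq_single i]
  · rw [smul_mul_smul_comm, (hp i).isIdempotentElem.eq]
  · intro j _ hj
    rw [smul_mul_smul_comm, mul_eq_zero_of_sum_isStarProjection_eq_one hp hsum hj.symm, smul_zero]
  · simp

theorem sum_smul_mem_unitary {A ι : Type*} [CStarAlgebra A] [Fintype ι] {p : ι → A}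
    (hp : ∀ i, IsStarProjection (p i)) (hsum : ∑ i, p i = 1) {z : ι → ℂ}
    (hz : ∀ i, star (z i) * z i = 1) : ∑ i, z i • p i ∈ unitary A := by
  have star_sum_smul : star (∑ i, z i • p i) = ∑ i, star (z i) • p i := by
    simp only [star_sum, star_smul, (hp _).isSelfAdjoint.star_eq]
  rw [Unitary.mem_iff, star_sum_smul, sum_smul_mul_sum_smul hp hsum,
    sum_smul_mul_sum_smul hp hsum]
  simp only [mul_comm (z _), hz, one_smul, hsum, and_self]

theorem conjStarAlgAut_eq_smul {A : Type*} [CStarAlgebra A] (w : unitary A) {x : A} {z : ℂ}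
    (h : (w : A) * x = z • (x * w)) : Unitary.conjStarAlgAut ℂ A w x = z • x := by
  rw [Unitary.conjStarAlgAut_apply, h, smul_mul_assoc, mul_assoc, Unitary.mul_star_self_of_mem w.2,
    mul_one]

variable {R : Type*} [CommRing R]

theorem val_ofAdd_congr {k : R} {σ : Dual (Multiplicative R)}
    (hσ : ∀ n, k ∣ n → σ.val (ofAdd n) = 1) {a b : R} (h : k ∣ a - b) :
    σ.val (ofAdd a) = σ.val (ofAdd b) := by
  rw [← sub_add_cancel a b, ofAdd_add, Dual.val_mul, hσ _ h, one_mul]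

variable [Ring.HasFiniteQuotients R] [Nontrivial R]

/-- The element of `𝔇[R]` with the value `σ(c)` on the projection `u^c e_k u^{-c}`. It is only
used for characters `σ` of `R` that are trivial on `(k)`. -/
def charUnitary (k : R⁰) (σ : Dual (Multiplicative R)) : Alg R :=
  ∑ c : R ⧸ Ideal.span {(k : R)}, σ.val (ofAdd c.out) • proj k c.out

theorem charUnitary_mem_unitary (k : R⁰) (σ : Dual (Multiplicative R)) :
    charUnitary k σ ∈ unitary (Alg R) :=
  sum_smul_mem_unitary (fun _ => isStarProjection_proj _ _) (sum_proj k)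
    fun _ => Dual.star_val_mul_val σ _

theorem commute_charUnitary_e (k m : R⁰) (σ : Dual (Multiplicative R)) :
    Commute (charUnitary k σ) (e m) := by
  have proj_zero : proj m 0 = e m := by rw [proj, neg_zero, coreWord_zero_zero]
  rw [← proj_zero]
  exact Commute.sum_left _ _ _ fun c _ => (commute_proj k m c.out 0).smul_left _

theorem charUnitary_mul_u {k : R⁰} {σ : Dual (Multiplicative R)}
    (hσ : ∀ n, (k : R) ∣ n → σ.val (ofAdd n) = 1) (n : R) :
    charUnitary k σ * u n = σ.val (ofAdd n) • (u n * charUnitary k σ) := by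
  let I : Ideal R := Ideal.span {(k : R)}
  have dvd_out_add (c : R ⧸ I) :
      (k : R) ∣ (c + Ideal.Quotient.mk I n).out - (n + c.out) := by
    rw [← Ideal.mem_span_singleton, ← Ideal.Quotient.eq, map_add, Ideal.Quotient.mk_out,
      Ideal.Quotient.mk_out, add_comm]
  rw [charUnitary, Finset.sum_mul, Finset.mul_sum, Finset.smul_sum]
  refine (Equiv.sum_comp (Equiv.addRight (Ideal.Quotient.mk I n)) _).symm.trans
    (Finset.sum_congr rfl fun c _ => ?_)
  rw [Equiv.coe_addRight, val_ofAdd_congr hσ (dvd_out_add c), proj_congr (dvd_out_add c),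
    smul_mul_assoc, mul_smul_comm, smul_smul, ofAdd_add, Dual.val_mul, coreWord_mul_u,
    u_mul_coreWord, neg_add_rev, neg_add_cancel_right]

theorem norm_twistedEvalHom_mul {k : R⁰} {σ : Dual (Multiplicative R)}
    (hσ : ∀ n, (k : R) ∣ n → σ.val (ofAdd n) = 1) (χ : Dual (Multiplicative R)) (p : Pre R) :
    ‖twistedEvalHom e u (fun _ => 1) ofAdd (σ * χ) p‖ =
      ‖twistedEvalHom e u (fun _ => 1) ofAdd χ p‖ := by
  let w : unitary (Alg R) := ⟨charUnitary k σ, charUnitary_mem_unitary k σ⟩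
  let conj : Alg R →⋆ₐ[ℂ] Alg R := Unitary.conjStarAlgAut ℂ (Alg R) w
  have conj_e (m : R⁰) : conj (e m) = e m :=
    (conjStarAlgAut_eq_smul w ((commute_charUnitary_e k m σ).eq.trans
      (one_smul ℂ _).symm)).trans (one_smul ℂ _)
  have conj_u (n : R) : conj (u n) = σ.val (ofAdd n) • u n :=
    conjStarAlgAut_eq_smul w (charUnitary_mul_u hσ n)
  have conj_comp : conj.comp (twistedEvalHom e u (fun _ => 1) ofAdd χ) =
      twistedEvalHom e u (fun _ => 1) ofAdd (σ * χ) := by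
    simp only [twistedEvalHom, comp_evalHom, map_smul, conj_e, conj_u, smul_smul, Dual.val_one,
      Dual.mul_val, mul_comm]
  rw [← conj_comp]
  exact NonUnitalStarAlgHom.norm_map conj (EquivLike.injective (Unitary.conjStarAlgAut ℂ _ w)) _

end CharUnitary

/-! ### The action of the dual of `(R, +)` on `𝔅` -/

section AddAction

open Multiplicative (ofAdd)

variable {R : Type*} [CommRing R]

theorem isClosed_diagAlg : IsClosed (diagAlg R : Set (Alg R)) :=
  StarSubalgebra.isClosed_topologicalClosure _

theorem isClosed_coreAlg : IsClosed (coreAlg R : Set (Alg R)) :=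
  StarSubalgebra.isClosed_topologicalClosure _

attribute [local instance] isClosed_coreAlg

theorem coe_evalHom_coreE_coreU (p : Pre R) :
    (evalHom coreE coreU p : Alg R) = evalHom e u p :=
  DFunLike.congr_fun (comp_evalHom (a := coreE) (b := coreU) (coreAlg R).subtype) p

theorem coe_twistedEvalHom_coreE_coreU {G : Type*} [CommGroup G] (v : R⁰ → G) (w : R → G)
    (χ : Dual G) (p : Pre R) :
    (twistedEvalHom coreE coreU v w χ p : Alg R) = twistedEvalHom e u v w χ p :=
  DFunLike.congr_fun (comp_evalHom (a := fun m => χ.val (v m) • coreE m)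
    (b := fun n => χ.val (w n) • coreU n) (coreAlg R).subtype) p

theorem denseRange_evalHom_coreE_coreU : DenseRange (evalHom (R := R) coreE coreU) := by
  have adjoin_le : StarAlgebra.adjoin ℂ (Set.range (e (R := R)) ∪ Set.range u) ≤
      (evalHom e u).range := by
    refine StarAlgebra.adjoin_le ?_
    rintro _ (⟨m, rfl⟩ | ⟨n, rfl⟩)
    · exact ⟨preS m, evalHom_preS m⟩
    · exact ⟨preU n, evalHom_preU n⟩
  intro y
  rw [Topology.IsInducing.subtypeVal.closure_eq_preimage_closure_image]
  refine closure_mono (fun x hx => ?_) y.2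
  obtain ⟨p, rfl⟩ := adjoin_le hx
  exact ⟨_, ⟨p, rfl⟩, coe_evalHom_coreE_coreU p⟩

variable [IsDomain R]

theorem exists_mem_nonZeroDivisors_not_dvd (hR : ¬ IsField R) {n : R} (hn : n ≠ 0) :
    ∃ k : R⁰, ¬ (k : R) ∣ n := by
  obtain ⟨r, hr, not_isUnit⟩ := Ring.exists_not_isUnit_of_not_isField hR
  refine ⟨⟨r * n, mem_nonZeroDivisors_of_ne_zero (mul_ne_zero hr hn)⟩, fun h => not_isUnit ?_⟩
  exact isUnit_of_dvd_one ((mul_dvd_mul_iff_right hn).1 (by rwa [one_mul]))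

theorem exists_character_of_not_isField (hR : ¬ IsField R) {n : R} (hn : n ≠ 0) :
    ∃ (k : R⁰) (σ : Dual (Multiplicative R)),
      (∀ a, (k : R) ∣ a → σ.val (ofAdd a) = 1) ∧ σ.val (ofAdd n) ≠ 1 := by
  obtain ⟨k, hk⟩ := exists_mem_nonZeroDivisors_not_dvd hR hn
  let quotientMap : Multiplicative R →* Multiplicative (R ⧸ Ideal.span {(k : R)}) :=
    (Ideal.Quotient.mk _ : R →+* _).toAddMonoidHom.toMultiplicative
  have quotientMap_eq_one (a : R) : quotientMap (ofAdd a) = 1 ↔ (k : R) ∣ a :=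
    (Ideal.Quotient.eq_zero_iff_mem).trans Ideal.mem_span_singleton
  obtain ⟨γ, hγ⟩ := Dual.exists_val_ne_one (mt (quotientMap_eq_one n).1 hk)
  exact ⟨k, Dual.ofHom (γ.toMonoidHom.comp quotientMap), fun a ha =>
    (congrArg γ.val ((quotientMap_eq_one a).2 ha)).trans γ.val_one, hγ⟩

variable [Ring.HasFiniteQuotients R]

theorem norm_twistedEvalHom (hR : ¬ IsField R) (χ : Dual (Multiplicative R)) (p : Pre R) :
    ‖twistedEvalHom e u (fun _ => 1) ofAdd χ p‖ = ‖evalHom (R := R) e u p‖ := by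
  let F (χ : Dual (Multiplicative R)) : ℂ := ‖twistedEvalHom e u (fun _ => 1) ofAdd χ p‖
  have F_continuous : Continuous F :=
    Complex.continuous_ofReal.comp (continuous_twistedEvalHom e u _ _ p).norm
  have F_eq : F χ = F 1 := Dual.eq_of_forall_translation_invariant F_continuous (fun n hn => by
    obtain ⟨k, σ, hσ, hσn⟩ := exists_character_of_not_isField hR (n := n.toAdd) hn
    exact ⟨σ, hσn, fun χ => congrArg Complex.ofReal (norm_twistedEvalHom_mul hσ χ p)⟩) χ 1
  have twistedEvalHom_one : twistedEvalHom e u (fun _ => 1) ofAdd 1 = evalHom (R := R) e u := by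
    simp only [twistedEvalHom, Dual.one_val, one_smul]
  rw [← twistedEvalHom_one]
  exact Complex.ofReal_injective F_eq

theorem exists_isAddDualAction (hR : ¬ IsField R) :
    ∃ β : Dual (Multiplicative R) →* (coreAlg R ≃⋆ₐ[ℂ] coreAlg R), IsAddDualAction β := by
  obtain ⟨β, apply_e, apply_u, hβ⟩ := exists_dualAction (v := fun _ : R⁰ => 1) (w := ofAdd)
    (denseRange_evalHom_coreE_coreU (R := R)) fun χ p => by
      calc ‖twistedEvalHom coreE coreU (fun _ => 1) ofAdd χ p‖
          = ‖twistedEvalHom e u (fun _ => 1) ofAdd χ p‖ :=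
        congrArg norm (coe_twistedEvalHom_coreE_coreU _ _ χ p)
      _ = ‖evalHom (R := R) e u p‖ := norm_twistedEvalHom hR χ p
      _ ≤ ‖evalHom coreE coreU p‖ := (congrArg norm (coe_evalHom_coreE_coreU p)).ge
  exact ⟨β, fun χ m => by rw [apply_e, Dual.val_one, one_smul], apply_u, hβ⟩

end AddAction

/-! ### Averages of `*`-homomorphisms -/

section Average

open MeasureTheory

theorem exists_star_mul_self_of_nonneg {A : Type*} [CStarAlgebra A] [PartialOrder A]
    [StarOrderedRing A] {D : StarSubalgebra ℂ A} (hD : IsClosed (D : Set A)) {d : D}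
    (hd : 0 ≤ (d : A)) : ∃ y : D, d = star y * y := by
  let r : A := cfc Real.sqrt (d : A)
  have star_r : star r = r := (cfc_predicate Real.sqrt (d : A)).star_eq
  have r_mul_r : r * r = d := by
    rw [← cfc_mul Real.sqrt Real.sqrt (d : A)]
    exact (cfc_congr fun x hx => Real.mul_self_sqrt (spectrum_nonneg_of_nonneg hd hx)).trans
      (cfc_id' ℝ (d : A))
  exact ⟨⟨r, cfc_mem (𝕜' := ℂ) (hs := hD) Real.sqrt d.2⟩,
    Subtype.ext (r_mul_r.symm.trans (congrArg (· * r) star_r.symm))⟩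

variable {K A B : Type*} [TopologicalSpace K] [CompactSpace K] [MeasurableSpace K]
  [BorelSpace K] [CStarAlgebra A] [CStarAlgebra B]

/-- A positive functional that separates `f k` from `0` has a positive integral along `f`. -/
theorem eq_zero_of_integral_eq_zero [PartialOrder B] [StarOrderedRing B] {μ : Measure K}
    [IsFiniteMeasure μ] [μ.IsOpenPosMeasure] {f : K → B} (hf : Continuous f)
    (f_nonneg : ∀ k, 0 ≤ f k) (h : ∫ k, f k ∂μ = 0) (k : K) : f k = 0 := by
  by_contra f_ne_zero
  have neg_notMem : -f k ∉ ProperCone.positive ℝ B := fun hmem =>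
    f_ne_zero (le_antisymm (neg_nonneg.1 hmem) (f_nonneg k))
  obtain ⟨ω, ω_nonneg, ω_neg⟩ := ProperCone.hyperplane_separation_point _ neg_notMem
  rw [map_neg, neg_lt_zero] at ω_neg
  have integral_pos : 0 < ∫ k, ω (f k) ∂μ :=
    Continuous.integral_pos_of_hasCompactSupport_nonneg_nonzero (x := k)
      (ω.continuous.comp hf) (HasCompactSupport.of_compactSpace _)
      (fun k => ω_nonneg _ (f_nonneg k)) ω_neg.ne'
  rw [ω.integral_comp_comm (integrable_of_continuous hf), h, map_zero] at integral_pos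
  exact integral_pos.false

variable (μ : Measure K) [IsProbabilityMeasure μ] {f : K → A →⋆ₐ[ℂ] B}
  (hf : ∀ x, Continuous fun k => f k x)

/-- The average of a point-norm continuous family of `*`-homomorphisms. -/
def average : A →L[ℂ] B :=
  LinearMap.mkContinuous
    { toFun x := ∫ k, f k x ∂μ
      map_add' x y := by
        simp only [map_add]
        exact integral_add (integrable_of_continuous (hf x)) (integrable_of_continuous (hf y))
      map_smul' c x := by
        simp only [map_smul, RingHom.id_apply]
        exact integral_smul c _ } 1
    fun x => (norm_integral_le_of_norm_le_const (.of_forall fun k =>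
      NonUnitalStarAlgHom.norm_apply_le (f k) x)).trans_eq (by simp [mul_comm])

theorem average_apply (x : A) : average μ hf x = ∫ k, f k x ∂μ := rfl

theorem norm_average_le (x : A) : ‖average μ hf x‖ ≤ ‖x‖ :=
  (ContinuousLinearMap.le_of_opNorm_le _
    (LinearMap.mkContinuous_norm_le _ zero_le_one _) x).trans_eq (one_mul _)

variable {μ hf}

theorem average_of_forall_eq {x : A} {y : B} (h : ∀ k, f k x = y) : average μ hf x = y := by
  simp only [average_apply, h, integral_const, probReal_univ, one_smul]

theorem average_mul_left {d : A} {d' : B} (hd : ∀ k, f k d = d') (x : A) :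
    average μ hf (d * x) = d' * average μ hf x := by
  simp only [average_apply, map_mul, hd]
  exact integral_const_mul_of_integrable (integrable_of_continuous (hf x))

theorem average_mul_right {d : A} {d' : B} (hd : ∀ k, f k d = d') (x : A) :
    average μ hf (x * d) = average μ hf x * d' := by
  simp only [average_apply, map_mul, hd]
  exact integral_mul_const_of_integrable (integrable_of_continuous (hf x))

theorem apply_star_mul_self_nonneg [PartialOrder B] [StarOrderedRing B] (g : A →⋆ₐ[ℂ] B) (x : A) :
    0 ≤ g (star x * x) := by
  rw [map_mul, map_star]
  exact star_mul_self_nonneg _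

theorem exists_average_star_mul_self_eq {D : StarSubalgebra ℂ B} (hD : IsClosed (D : Set B))
    {x : A} {d : D} (hd : average μ hf (star x * x) = d) : ∃ y : D, d = star y * y := by
  let _ := CStarAlgebra.spectralOrder B
  let _ := CStarAlgebra.spectralOrderedRing B
  refine exists_star_mul_self_of_nonneg hD ?_
  rw [← hd, average_apply]
  exact integral_nonneg fun k => apply_star_mul_self_nonneg (f k) x

theorem eq_zero_of_average_star_mul_self_eq_zero [μ.IsOpenPosMeasure] {k : K}
    (hk : Function.Injective (f k)) {x : A} (h : average μ hf (star x * x) = 0) : x = 0 := by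
  let _ := CStarAlgebra.spectralOrder B
  let _ := CStarAlgebra.spectralOrderedRing B
  have apply_eq_zero : f k (star x * x) = 0 := eq_zero_of_integral_eq_zero (hf _)
    (fun k => apply_star_mul_self_nonneg (f k) x) h k
  exact (CStarRing.star_mul_self_eq_zero_iff x).1 (hk (apply_eq_zero.trans (map_zero _).symm))

theorem average_of_forall_eq_val_smul {G : Type*} [CommGroup G] {f : Dual G → A →⋆ₐ[ℂ] B}
    {hf : ∀ x, Continuous fun χ => f χ x} {x : A} {y : B} {g : G}
    (h : ∀ χ, f χ x = χ.val g • y) : average (dualHaar G) hf x = delta g 1 • y := by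
  simp only [average_apply, h, integral_smul_const, integral_val]

end Average

/-! ### The conditional expectation onto `𝔇[R]` -/

section Expectation

open Multiplicative (ofAdd)

theorem delta_self {ι : Type*} (i : ι) : delta i i = 1 := if_pos rfl

theorem delta_of_ne {ι : Type*} {i j : ι} (h : i ≠ j) : delta i j = 0 := if_neg h

theorem delta_congr {ι κ : Type*} {i j : ι} {k l : κ} (h : i = j ↔ k = l) :
    delta i j = delta k l := by
  classical exact if_congr h rfl rfl

attribute [local instance] isClosed_coreAlg

variable {R : Type*} [CommRing R]

theorem coreWord_mem_coreAlg (k : R⁰) (a b : R) : coreWord k a b ∈ coreAlg R :=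
  (coreU a * coreE k * coreU b).2

theorem proj_mem_diagAlg (k : R⁰) (n : R) : proj k n ∈ diagAlg R :=
  StarSubalgebra.le_topologicalClosure _ (StarAlgebra.subset_adjoin ℂ _ (proj_mem_projSet k n))

theorem diagAlg_le_of_proj_mem {S : StarSubalgebra ℂ (Alg R)} (hS : IsClosed (S : Set (Alg R)))
    (h : ∀ k n, proj k n ∈ S) : diagAlg R ≤ S := by
  refine StarSubalgebra.topologicalClosure_minimal (StarAlgebra.adjoin_le ?_) hS
  rintro _ ⟨k, n, rfl⟩
  exact h k n

theorem diagAlg_le_coreAlg : diagAlg R ≤ coreAlg R :=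
  diagAlg_le_of_proj_mem isClosed_coreAlg fun k n => coreWord_mem_coreAlg k n (-n)

variable {α : Dual (FractionRing R)ˣ →* (Alg R ≃⋆ₐ[ℂ] Alg R)}
  {β : Dual (Multiplicative R) →* (coreAlg R ≃⋆ₐ[ℂ] coreAlg R)}

theorem IsMulDualAction.apply_coreWord (hα : IsMulDualAction α) (φ : Dual (FractionRing R)ˣ)
    (k : R⁰) (a b : R) : α φ (coreWord k a b) = coreWord k a b := by
  rw [coreWord, e, map_mul, map_mul, map_mul, map_star, hα.apply_s, hα.apply_u, hα.apply_u,
    star_smul, smul_mul_smul_comm, mul_comm (φ.val _), Dual.star_val_mul_val, one_smul]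

theorem IsMulDualAction.apply_word (hα : IsMulDualAction α) (φ : Dual (FractionRing R)ˣ)
    (m k : R⁰) (a b : R) (m' : R⁰) :
    α φ (word m k a b m') = φ.val ((toFrac m)⁻¹ * toFrac m') • word m k a b m' := by
  rw [word, map_mul, map_mul, map_star, hα.apply_s, hα.apply_s, hα.apply_coreWord, star_smul,
    smul_mul_assoc, smul_mul_smul_comm, Dual.star_val, ← Dual.val_mul]

open scoped CStarAlgebra in
theorem IsMulDualAction.apply_of_mem_diagAlg (hα : IsMulDualAction α)
    (φ : Dual (FractionRing R)ˣ) {d : Alg R} (hd : d ∈ diagAlg R) : α φ d = d := by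
  let π : Alg R →⋆ₐ[ℂ] Alg R := α φ
  suffices h : diagAlg R ≤ StarAlgHom.equalizer π (StarAlgHom.id ℂ (Alg R)) from h hd
  exact diagAlg_le_of_proj_mem (isClosed_eq (map_continuous π) continuous_id)
    fun k n => hα.apply_coreWord φ k n (-n)

theorem IsAddDualAction.apply_coreWord (hβ : IsAddDualAction β) (χ : Dual (Multiplicative R))
    {y : coreAlg R} {k : R⁰} {a b : R} (hy : (y : Alg R) = coreWord k a b) :
    β χ y = χ.val (ofAdd (a + b)) • y := by
  obtain rfl : y = coreU a * coreE k * coreU b := Subtype.ext hy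
  rw [map_mul, map_mul, hβ.apply_u, hβ.apply_e, hβ.apply_u, smul_mul_assoc, smul_mul_smul_comm,
    ← Dual.val_mul, ← ofAdd_add]

open scoped CStarAlgebra in
theorem IsAddDualAction.apply_of_mem_diagAlg (hβ : IsAddDualAction β)
    (χ : Dual (Multiplicative R)) {y : coreAlg R} (hy : (y : Alg R) ∈ diagAlg R) :
    β χ y = y := by
  let π : coreAlg R →⋆ₐ[ℂ] coreAlg R := β χ
  let fixed : StarSubalgebra ℂ (coreAlg R) :=
    StarAlgHom.equalizer π (StarAlgHom.id ℂ (coreAlg R))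
  have isClosed_fixed : IsClosed (fixed : Set (coreAlg R)) :=
    isClosed_eq (map_continuous π) continuous_id
  have diagAlg_le : diagAlg R ≤ fixed.map (coreAlg R).subtype := by
    refine diagAlg_le_of_proj_mem
      (isClosed_coreAlg.isClosedEmbedding_subtypeVal.isClosedMap _ isClosed_fixed) fun k n => ?_
    refine ⟨⟨proj k n, coreWord_mem_coreAlg k n (-n)⟩, ?_, rfl⟩
    change β χ _ = ⟨proj k n, _⟩
    rw [hβ.apply_coreWord χ rfl, add_neg_cancel, ofAdd_zero, Dual.val_one, one_smul]
  obtain ⟨y', hy', coe_eq⟩ := diagAlg_le hy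
  obtain rfl : y' = y := Subtype.ext coe_eq
  exact hy'

variable (hα : IsMulDualAction α) (hβ : IsAddDualAction β)

/-- The average `∫ α_φ(x) dφ` over the dual of `Q(R)^×`. -/
def mulAverage : Alg R →L[ℂ] Alg R :=
  average (dualHaar (FractionRing R)ˣ) (f := fun φ => (α φ : Alg R →⋆ₐ[ℂ] Alg R)) hα.continuous

/-- The average `∫ β_χ(y) dχ` over the dual of `(R, +)`. -/
def addAverage : coreAlg R →L[ℂ] Alg R :=
  average (dualHaar (Multiplicative R))
    (f := fun χ => (coreAlg R).subtype.comp (β χ : coreAlg R →⋆ₐ[ℂ] coreAlg R))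
    fun y => continuous_subtype_val.comp (hβ.continuous y)

theorem mulAverage_word (m k : R⁰) (a b : R) (m' : R⁰) :
    mulAverage hα (word m k a b m') = delta m m' • word m k a b m' := by
  rw [delta_congr (k := (toFrac m)⁻¹ * toFrac m') (l := 1)
    (by rw [inv_mul_eq_one, toFrac_injective.eq_iff])]
  exact average_of_forall_eq_val_smul fun φ => hα.apply_word φ m k a b m'

theorem addAverage_of_eq_coreWord {y : coreAlg R} {k : R⁰} {a b : R}
    (hy : (y : Alg R) = coreWord k a b) :
    addAverage hβ y = delta (a + b) 0 • (y : Alg R) :=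
  average_of_forall_eq_val_smul (g := ofAdd (a + b)) fun χ =>
    congrArg Subtype.val (hβ.apply_coreWord χ hy)

variable [Ring.HasFiniteQuotients R] [Nontrivial R]

theorem word_self_mem_coreAlg (m k : R⁰) (a b : R) : word m k a b m ∈ coreAlg R :=
  word_self_mem (S := (coreAlg R).toSubalgebra.toSubmodule) fun x y _ => coreWord_mem_coreAlg k x y

theorem word_self_mem_diagAlg (m k : R⁰) {a b : R} (hab : a + b = 0) :
    word m k a b m ∈ diagAlg R := by
  refine word_self_mem (S := (diagAlg R).toSubalgebra.toSubmodule) fun x y hxy => ?_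
  rw [hab, mul_left_coe_nonZeroDivisors_eq_zero_iff] at hxy
  rw [eq_neg_of_add_eq_zero_right hxy]
  exact proj_mem_diagAlg k x

theorem addAverage_of_eq_word {y : coreAlg R} {m k : R⁰} {a b : R}
    (hy : (y : Alg R) = word m k a b m) : addAverage hβ y = delta (a + b) 0 • (y : Alg R) := by
  let incl : coreAlg R →ₗ[ℂ] Alg R := (coreAlg R).subtype
  let S : Submodule ℂ (coreAlg R) := LinearMap.eqLocus (addAverage hβ) (delta (a + b) 0 • incl)
  have mem_map : word m k a b m ∈ S.map incl := word_self_mem fun x z hxz => by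
    refine ⟨⟨_, coreWord_mem_coreAlg k x z⟩, ?_, rfl⟩
    refine (addAverage_of_eq_coreWord hβ rfl).trans (congrArg (· • coreWord k x z) ?_)
    exact delta_congr (by rw [← hxz, mul_left_coe_nonZeroDivisors_eq_zero_iff])
  obtain ⟨y', hy', coe_eq⟩ := mem_map
  obtain rfl : y' = y := Subtype.ext (coe_eq.trans hy.symm)
  exact hy'

theorem mulAverage_mem_coreAlg (x : Alg R) : mulAverage hα x ∈ coreAlg R := by
  let S : Submodule ℂ (Alg R) :=
    (coreAlg R).toSubalgebra.toSubmodule.comap (mulAverage hα : Alg R →ₗ[ℂ] Alg R)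
  refine mem_of_forall_word_mem (S := S) (isClosed_coreAlg.preimage (mulAverage hα).continuous)
    (fun m k a b m' => ?_) x
  change mulAverage hα (word m k a b m') ∈ coreAlg R
  rw [mulAverage_word]
  obtain rfl | hne := eq_or_ne m m'
  · exact SMulMemClass.smul_mem _ (word_self_mem_coreAlg m k a b)
  · rw [delta_of_ne hne, zero_smul]
    exact zero_mem _

/-- The average over the dual of `Q(R)^×`, with values in `𝔅`. -/
def coreExpectation : Alg R →L[ℂ] coreAlg R :=
  (mulAverage hα).codRestrict (coreAlg R).toSubalgebra.toSubmodule (mulAverage_mem_coreAlg hα)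

theorem addAverage_coreExpectation_word (m k : R⁰) (a b : R) (m' : R⁰) :
    addAverage hβ (coreExpectation hα (word m k a b m')) =
      (delta m m' * delta (a + b) 0) • word m k a b m := by
  obtain rfl | hne := eq_or_ne m m'
  · have coreExpectation_word : coreExpectation hα (word m k a b m) =
        ⟨word m k a b m, word_self_mem_coreAlg m k a b⟩ :=
      Subtype.ext ((mulAverage_word hα m k a b m).trans (by rw [delta_self, one_smul]))
    rw [coreExpectation_word, addAverage_of_eq_word hβ rfl, delta_self,
      one_mul]
  · have coreExpectation_word : coreExpectation hα (word m k a b m') = 0 :=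
      Subtype.ext ((mulAverage_word hα m k a b m').trans (by rw [delta_of_ne hne, zero_smul]; rfl))
    rw [coreExpectation_word, map_zero, delta_of_ne hne, zero_mul, zero_smul]

theorem addAverage_coreExpectation_mem_diagAlg (x : Alg R) :
    addAverage hβ (coreExpectation hα x) ∈ diagAlg R := by
  let doubleAverage : Alg R →L[ℂ] Alg R := (addAverage hβ).comp (coreExpectation hα)
  let S : Submodule ℂ (Alg R) :=
    (diagAlg R).toSubalgebra.toSubmodule.comap (doubleAverage : Alg R →ₗ[ℂ] Alg R)
  refine mem_of_forall_word_mem (S := S) (isClosed_diagAlg.preimage doubleAverage.continuous)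
    (fun m k a b m' => ?_) x
  change addAverage hβ (coreExpectation hα (word m k a b m')) ∈ diagAlg R
  rw [addAverage_coreExpectation_word]
  by_cases hab : a + b = 0
  · exact SMulMemClass.smul_mem _ (word_self_mem_diagAlg m k hab)
  · rw [delta_of_ne hab, mul_zero, zero_smul]
    exact zero_mem _

/-- The conditional expectation onto `𝔇[R]` obtained by averaging first over the dual of
`Q(R)^×` and then over the dual of `(R, +)`. -/
def expectation : Alg R →L[ℂ] diagAlg R :=
  ((addAverage hβ).comp (coreExpectation hα)).codRestrict (diagAlg R).toSubalgebra.toSubmodule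
    (addAverage_coreExpectation_mem_diagAlg hα hβ)

theorem coe_expectation (x : Alg R) :
    (expectation hα hβ x : Alg R) = addAverage hβ (coreExpectation hα x) := rfl

theorem expectation_coe (d : diagAlg R) : expectation hα hβ d = d := by
  have coreExpectation_coe : coreExpectation hα d = ⟨d, diagAlg_le_coreAlg d.2⟩ :=
    Subtype.ext (average_of_forall_eq fun φ => hα.apply_of_mem_diagAlg φ d.2)
  refine Subtype.ext ?_
  rw [coe_expectation, coreExpectation_coe]
  exact average_of_forall_eq fun χ => congrArg Subtype.val (hβ.apply_of_mem_diagAlg χ d.2)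

theorem expectation_mul_left (d : diagAlg R) (x : Alg R) :
    expectation hα hβ (d * x) = d * expectation hα hβ x := by
  have coreExpectation_mul :
      coreExpectation hα (d * x) = ⟨d, diagAlg_le_coreAlg d.2⟩ * coreExpectation hα x :=
    Subtype.ext (average_mul_left (fun φ => hα.apply_of_mem_diagAlg φ d.2) x)
  refine Subtype.ext ?_
  rw [coe_expectation, coreExpectation_mul]
  exact average_mul_left (fun χ => congrArg Subtype.val (hβ.apply_of_mem_diagAlg χ d.2)) _

theorem expectation_mul_right (x : Alg R) (d : diagAlg R) :
    expectation hα hβ (x * d) = expectation hα hβ x * d := by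
  have coreExpectation_mul :
      coreExpectation hα (x * d) = coreExpectation hα x * ⟨d, diagAlg_le_coreAlg d.2⟩ :=
    Subtype.ext (average_mul_right (fun φ => hα.apply_of_mem_diagAlg φ d.2) x)
  refine Subtype.ext ?_
  rw [coe_expectation, coreExpectation_mul]
  exact average_mul_right (fun χ => congrArg Subtype.val (hβ.apply_of_mem_diagAlg χ d.2)) _

theorem exists_coreExpectation_star_mul_self_eq (x : Alg R) :
    ∃ y : coreAlg R, coreExpectation hα (star x * x) = star y * y :=
  exists_average_star_mul_self_eq isClosed_coreAlg rfl

theorem isCondExp_expectation : IsCondExp (diagAlg R) (expectation hα hβ) where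
  contractive x :=
    calc ‖addAverage hβ (coreExpectation hα x)‖ ≤ ‖mulAverage hα x‖ := norm_average_le _ _ _
      _ ≤ ‖x‖ := norm_average_le _ _ x
  positive x := by
    obtain ⟨y, hy⟩ := exists_coreExpectation_star_mul_self_eq hα x
    exact exists_average_star_mul_self_eq isClosed_diagAlg (congrArg (addAverage hβ) hy).symm
  apply_coe := expectation_coe hα hβ
  left_mul := expectation_mul_left hα hβ
  right_mul := expectation_mul_right hα hβ

theorem isFaithful_expectation : IsFaithful (expectation hα hβ) := by
  intro x hx
  obtain ⟨y, hy⟩ := exists_coreExpectation_star_mul_self_eq hα x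
  have addAverage_eq_zero : addAverage hβ (star y * y) = 0 := by
    rw [← hy, ← coe_expectation, hx]
    rfl
  have y_eq_zero : y = 0 := eq_zero_of_average_star_mul_self_eq_zero (k := 1)
    (Subtype.val_injective.comp (EquivLike.injective (β 1))) addAverage_eq_zero
  have mulAverage_eq_zero : mulAverage hα (star x * x) = 0 := by
    rw [y_eq_zero, mul_zero] at hy
    exact congrArg Subtype.val hy
  exact eq_zero_of_average_star_mul_self_eq_zero (k := 1)
    (EquivLike.injective (α 1)) mulAverage_eq_zero

theorem standardFormula_expectation : StandardFormula (expectation hα hβ) := by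
  rintro m m' n n' _ ⟨k, a, rfl⟩
  have eq_word (n' : R) (m' : R⁰) :
      star (s m) * u n * (u a * e k * u (-a)) * u (-n') * s m' =
        word m k (n + a) (-a + -n') m' := by
    rw [word, ← coreWord_mul_u, ← u_mul_coreWord, coreWord]
    simp only [mul_assoc]
  have delta_eq : delta (n + a + (-a + -n')) 0 = delta n n' :=
    delta_congr (by rw [add_assoc, add_neg_cancel_left, ← sub_eq_add_neg, sub_eq_zero])
  rw [coe_expectation, eq_word, eq_word, addAverage_coreExpectation_word, delta_eq]
  obtain rfl | hne := eq_or_ne n n'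
  · rfl
  · rw [delta_of_ne hne, mul_zero, zero_smul, zero_smul]

theorem StandardFormula.ext {Θ Ψ : Alg R →L[ℂ] diagAlg R} (hΘ : StandardFormula Θ)
    (hΨ : StandardFormula Ψ) : Θ = Ψ := by
  refine ext_of_word fun m k a b m' => ?_
  have word_eq : word m k a b m' = star (s m) * u a * proj k 0 * u (-(-b)) * s m' := by
    rw [word, proj, neg_zero, neg_neg, coreWord_zero_zero, coreWord]
    simp only [mul_assoc]
  rw [word_eq]
  exact Subtype.ext ((hΘ m m' a (-b) _ (proj_mem_projSet k 0)).trans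
    (hΨ m m' a (-b) _ (proj_mem_projSet k 0)).symm)

theorem isDoubleAverage_expectation : IsDoubleAverage (expectation hα hβ) α β :=
  fun x => ⟨coreExpectation hα x, rfl, rfl⟩

end Expectation

end RingCStar

end

theorem mainTheorem2 (R : Type*) [CommRing R] [IsDomain R] (hfield : ¬ IsField R)
    (hfin : ∀ m : R, m ≠ 0 → Finite (R ⧸ Ideal.span {m})) :
    (∀ x ∈ RingCStar.diagAlg R, ∀ y ∈ RingCStar.diagAlg R, x * y = y * x) ∧
    ∃ Θ : RingCStar.Alg R →L[ℂ] RingCStar.diagAlg R,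
      RingCStar.IsCondExp (RingCStar.diagAlg R) Θ ∧
      RingCStar.IsFaithful Θ ∧
      RingCStar.StandardFormula Θ ∧
      (∀ Ψ : RingCStar.Alg R →L[ℂ] RingCStar.diagAlg R, RingCStar.StandardFormula Ψ → Ψ = Θ) ∧
      ∃ (α : RingCStar.Dual (FractionRing R)ˣ →* (RingCStar.Alg R ≃⋆ₐ[ℂ] RingCStar.Alg R))
        (β : RingCStar.Dual (Multiplicative R) →*
          (RingCStar.coreAlg R ≃⋆ₐ[ℂ] RingCStar.coreAlg R)),
        RingCStar.IsMulDualAction α ∧ RingCStar.IsAddDualAction β ∧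
        RingCStar.IsDoubleAverage Θ α β := by
  have := RingCStar.hasFiniteQuotients_of_principal hfin
  obtain ⟨α, hα⟩ := RingCStar.exists_isMulDualAction (R := R)
  obtain ⟨β, hβ⟩ := RingCStar.exists_isAddDualAction hfield
  exact ⟨RingCStar.diagAlg_mul_comm, RingCStar.expectation hα hβ,
    RingCStar.isCondExp_expectation hα hβ,
    RingCStar.isFaithful_expectation hα hβ,
    RingCStar.standardFormula_expectation hα hβ,
    fun _ hΨ => hΨ.ext (RingCStar.standardFormula_expectation hα hβ),
    α, β, hα, hβ, RingCStar.isDoubleAverage_expectation hα hβ⟩
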